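/- **Theorem.** Let $K$ be a field of characteristic zero and $\lambda\in K$. For a homogeneous element $x$ of a $\mathbb Z$-graded vector space its degree is also written $x$ in exponents of $-1$. *Setting.* A symmetric graded Lie algebra is a $\mathbb Z$-graded $K$-vector space $\mathfrak g$ with a bilinear bracket of degree $1$ such that, for homogeneous $x,y,z$, $[x,y]=(-1)^{xy}[y,x]$ and $[x,[y,z]]=(-1)^{x+1}[[x,y],z]+(-1)^{(x+1)(y+1)}[y,[x,z]]$. A derivation of degree $n$ of it is a linear map $D$ of degree $n$ with $D[x,y]=(-1)^n[Dx,y]+(-1)^{n(x+1)}[x,Dy]$. An action of $\mathfrak g$ on a symmetric graded Lie algebra $\mathfrak h$ is a linear map $\rho:\mathfrak g\to\mathrm{Der}(\mathfrak h)$ of degree $1$ with $\rho([x,y]_{\mathfrak g})=(-1)^{x+1}[\rho(x),\rho(y)]$ (graded commutator). Let $\rho$ be such an action. Let $\mathrm{Hom}^n(S(\mathfrak h),\mathfrak g)$ be the space of degree $n$ linear maps $f=\sum_{i\ge 0}f_i$, $f_i:S^i(\mathfrak h)\to\mathfrak g$, on the graded symmetric algebra. Let $\varepsilon(\sigma)$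 denote the Koszul sign, $\mathbb S_{(i_1,\dots,i_k)}$ the set of $(i_1,\dots,i_k)$-shuffles (empty if some $i_j<0$), and for homogeneous $v_1,\dots,v_p\in\mathfrak h$ and $i<j$ put $\alpha_{ij}=v_i(v_1+\dots+v_{i-1})+v_j(v_1+\dots+v_{j-1})+v_iv_j$. In the sums over $k+l=p+1$ one has $k\ge1$, $l\ge0$. An element $T=\sum_i T_i\in\mathrm{Hom}^0(S(\mathfrak h),\mathfrak g)$ is a *homotopy $\mathcal O$-operator of weight $\lambda$* with respect to $\rho$ if for all $p\ge0$ and all homogeneous $v_1,\dots,v_p\in\mathfrak h$ $$\sum_{i<j}(-1)^{\alpha_{ij}}T_{p-1}(\lambda[v_i,v_j]_{\mathfrak h},v_1,\dots,\hat v_i,\dots,\hat v_j,\dots,v_p)+\sum_{k+l=p+1}\sum_{\sigma\in\mathbb S_{(l,1,p-l-1)}}\varepsilon(\sigma)T_{k-1}\big(\rho(T_l(v_{\sigma(1)},\dots,v_{\sigma(l)}))v_{\sigma(l+1)},v_{\sigma(l+2)},\dots,v_{\sigma(p)}\big)$$ $$=\tfrac12\sum_{k+l=p+1}\sum_{\sigma\in\mathbb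 S_{(k-1,l)}}\varepsilon(\sigma)[T_{k-1}(v_{\sigma(1)},\dots,v_{\sigma(k-1)}),T_l(v_{\sigma(k)},\dots,v_{\sigma(p)})]_{\mathfrak g}.$$ On $sC^*(\mathfrak h,\mathfrak g)$, whose degree $n$ part is $\mathrm{Hom}^{n-1}(S(\mathfrak h),\mathfrak g)$, consider the differential, for $g\in\mathrm{Hom}^n(S(\mathfrak h),\mathfrak g)$, $$(d_\lambda g)_p(v_1,\dots,v_p)=\sum_{i<j}(-1)^{n+1+\alpha_{ij}}g_{p-1}(\lambda[v_i,v_j]_{\mathfrak h},v_1,\dots,\hat v_i,\dots,\hat v_j,\dots,v_p)\in\mathfrak g$$ and the bracket, for $f\in\mathrm{Hom}^m(S(\mathfrak h),\mathfrak g)$ and $g\in\mathrm{Hom}^n(S(\mathfrak h),\mathfrak g)$, $$[\![f,g]\!]_p(v_1,\dots,v_p)=-\sum_{k+l=p+1}\sum_{\sigma\in\mathbb S_{(l,1,p-l-1)}}\varepsilon(\sigma)f_{k-1}\big(\rho(g_l(v_{\sigma(1)},\dots,v_{\sigma(l)}))v_{\sigma(l+1)},v_{\sigma(l+2)},\dots,v_{\sigma(p)}\big)$$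 $$+(-1)^{(m+1)(n+1)}\sum_{k+l=p+1}\sum_{\sigma\in\mathbb S_{(k-1,1,p-k)}}\varepsilon(\sigma)g_l\big(\rho(f_{k-1}(v_{\sigma(1)},\dots,v_{\sigma(k-1)}))v_{\sigma(k)},v_{\sigma(k+1)},\dots,v_{\sigma(p)}\big)$$ $$-\sum_{k+l=p+1}\sum_{\sigma\in\mathbb S_{(k-1,l)}}(-1)^{n(v_{\sigma(1)}+\dots+v_{\sigma(k-1)})+m+1}\varepsilon(\sigma)[f_{k-1}(v_{\sigma(1)},\dots,v_{\sigma(k-1)}),g_l(v_{\sigma(k)},\dots,v_{\sigma(p)})]_{\mathfrak g}.$$ (1) A degree $0$ element $T\in\mathrm{Hom}^0(S(\mathfrak h),\mathfrak g)$ is a homotopy $\mathcal O$-operator of weight $\lambda$ with respect to $\rho$ if and only if $T$, regarded as an element of degree $1$, is a Maurer–Cartan element of $(sC^*(\mathfrak h,\mathfrak g),[\![\cdot,\cdot]\!],d_\lambda)$, that is, $d_\lambda T+\tfrac12[\![T,T]\!]=0$. (2) Let $\rho:\mathfrak g\to\mathrm{Der}(\mathfrak h)$ be an action of a Lie algebra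 $\mathfrak g$ on a Lie algebra $\mathfrak h$ over $K$ (ungraded, of any dimension). A linear map $T:\mathfrak h\to\mathfrak g$ is an $\mathcal O$-operator of weight $\lambda$, i.e. $[Tu,Tv]_{\mathfrak g}=T\big(\rho(Tu)v-\rho(Tv)u+\lambda[u,v]_{\mathfrak h}\big)$ for all $u,v\in\mathfrak h$, if and only if $T\in\mathrm{Hom}(\wedge^1\mathfrak h,\mathfrak g)$ is a Maurer–Cartan element ($d_\lambda T+\tfrac12[\![T,T]\!]=0$) of $\bigoplus_n\mathrm{Hom}(\wedge^n\mathfrak h,\mathfrak g)$, graded by $n$, with $$(d_\lambda g)(v_1,\dots,v_{n+1})=\sum_{i<j}(-1)^{n+i+j-1}g(\lambda[v_i,v_j]_{\mathfrak h},v_1,\dots,\hat v_i,\dots,\hat v_j,\dots,v_{n+1})$$ and, for $g_1\in\mathrm{Hom}(\wedge^n\mathfrak h,\mathfrak g)$, $g_2\in\mathrm{Hom}(\wedge^m\mathfrak h,\mathfrak g)$, $$[\![g_1,g_2]\!](v_1,\dots,v_{m+n})=-\sum_{\sigma\in\mathbb S_{(m,1,n-1)}}(-1)^\sigma g_1\big(\rho(g_2(v_{\sigma(1)},\dots,v_{\sigma(m)}))v_{\sigma(m+1)},v_{\sigma(m+2)},\dots,v_{\sigma(m+n)}\big)$$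 $$+(-1)^{mn}\sum_{\sigma\in\mathbb S_{(n,1,m-1)}}(-1)^\sigma g_2\big(\rho(g_1(v_{\sigma(1)},\dots,v_{\sigma(n)}))v_{\sigma(n+1)},v_{\sigma(n+2)},\dots,v_{\sigma(m+n)}\big)$$ $$-(-1)^{mn}\sum_{\sigma\in\mathbb S_{(n,m)}}(-1)^\sigma[g_1(v_{\sigma(1)},\dots,v_{\sigma(n)}),g_2(v_{\sigma(n+1)},\dots,v_{\sigma(m+n)})]_{\mathfrak g}.$$ -/

import Mathlib

namespace HomotopyO

open Equiv

/-- The Koszul sign `ε(σ; v₁, …, v_p)` of homogeneous elements of degrees `d₁, …, d_p`, determined by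
`v₁ ⊙ ⋯ ⊙ v_p = ε(σ; v₁, …, v_p) v_{σ(1)} ⊙ ⋯ ⊙ v_{σ(p)}`: each inversion of `σ` contributes the
sign `(-1)^{d d'}` of the exchange of two elements of degrees `d`, `d'`. -/
def koszulSign {p : ℕ} (σ : Perm (Fin p)) (d : Fin p → ℤ) : ℤˣ :=
  ∏ a, ∏ b, if a < b ∧ σ b < σ a then (d (σ a) * d (σ b)).negOnePow else 1

/-- The `(i₁, …, i_k)`-shuffles in `S_p`: the permutations which are increasing on every block of
positions, where the blocks are the level sets of `c`. -/
def shuffles {p : ℕ} (c : Fin p → ℕ) : Finset (Perm (Fin p)) :=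
  {σ | ∀ i j, i < j → c i = c j → σ i < σ j}

/-- The blocks of an `(a, p - a)`-shuffle. -/
def blocks₂ {p : ℕ} (a : ℕ) (i : Fin p) : ℕ := if (i : ℕ) < a then 0 else 1

/-- The blocks of an `(l, 1, p - l - 1)`-shuffle. -/
def blocks₃ {p : ℕ} (l : ℕ) (i : Fin p) : ℕ := if (i : ℕ) < l then 0 else if (i : ℕ) = l then 1 else 2

theorem mem_shuffles {p : ℕ} {c : Fin p → ℕ} {σ : Perm (Fin p)} :
    σ ∈ shuffles c ↔ ∀ i j, i < j → c i = c j → σ i < σ j := by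
  simp [shuffles]

theorem prod_lt_comp {p : ℕ} (σ : Perm (Fin p)) (Φ : Fin p → Fin p → ℤˣ)
    (h : ∀ a b, Φ a b = Φ b a) :
    (∏ a, ∏ b, if a < b then Φ (σ a) (σ b) else 1) = ∏ a, ∏ b, if a < b then Φ a b else 1 := by
  have e1 : (∏ a, ∏ b, if a < b then Φ a b else 1)
      = ∏ a, ∏ b, if σ a < σ b then Φ (σ a) (σ b) else 1 := by
    rw [← Equiv.prod_comp σ]
    refine Finset.prod_congr rfl fun a _ => ?_
    rw [← Equiv.prod_comp σ]
  have e2 : (∏ a, ∏ b, if σ a < σ b then Φ (σ a) (σ b) else 1)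
      = (∏ a, ∏ b, if a < b ∧ σ a < σ b then Φ (σ a) (σ b) else 1)
        * ∏ a, ∏ b, if b < a ∧ σ a < σ b then Φ (σ a) (σ b) else 1 := by
    simp only [← Finset.prod_mul_distrib]
    refine Finset.prod_congr rfl fun a _ => Finset.prod_congr rfl fun b _ => ?_
    rcases lt_trichotomy a b with hab | hab | hab
    · simp [hab, hab.not_gt]
    · simp [hab]
    · simp [hab, hab.not_gt]
  rw [e1, e2, Finset.prod_comm (f := fun a b => if b < a ∧ σ a < σ b then Φ (σ a) (σ b) else 1)]
  simp only [← Finset.prod_mul_distrib]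
  refine Finset.prod_congr rfl fun a _ => Finset.prod_congr rfl fun b _ => ?_
  by_cases hab : a < b
  · have hne : σ a ≠ σ b := fun hh => hab.ne (σ.injective hh)
    rcases lt_or_gt_of_ne hne with hh | hh
    · simp [hab, hh, hh.not_gt]
    · simp [hab, hh, hh.not_gt, h (σ a) (σ b)]
  · simp [hab]

theorem koszulSign_mul {p : ℕ} (π σ : Perm (Fin p)) (d : Fin p → ℤ) :
    koszulSign (π * σ) d = koszulSign π d * koszulSign σ (d ∘ π) := by
  have e : koszulSign π d = ∏ a, ∏ b, if a < b then
      (if (σ a < σ b ↔ π (σ a) < π (σ b)) then 1 else (d (π (σ a)) * d (π (σ b))).negOnePow)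
      else 1 := by
    rw [prod_lt_comp σ (fun a b => if (a < b ↔ π a < π b) then 1
      else (d (π a) * d (π b)).negOnePow)]
    · unfold koszulSign
      refine Finset.prod_congr rfl fun a _ => Finset.prod_congr rfl fun b _ => ?_
      by_cases hab : a < b
      · have hne : π a ≠ π b := fun hh => hab.ne (π.injective hh)
        rcases lt_or_gt_of_ne hne with hh | hh
        · simp [hab, hh, hh.not_gt]
        · simp [hab, hh, hh.not_gt]
      · simp [hab]
    · intro a b
      by_cases hab : a = b
      · simp [hab]
      · have hne : π a ≠ π b := fun hh => hab (π.injective hh)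
        have h1 : (a < b ↔ π a < π b) ↔ (b < a ↔ π b < π a) := by
          have hab' := lt_or_gt_of_ne hab
          have hne' := lt_or_gt_of_ne hne
          grind
        simp only [h1, mul_comm (d (π a))]
  rw [e]
  unfold koszulSign
  simp only [← Finset.prod_mul_distrib]
  refine Finset.prod_congr rfl fun a _ => Finset.prod_congr rfl fun b _ => ?_
  by_cases hab : a < b
  · have hne : σ a ≠ σ b := fun hh => hab.ne (σ.injective hh)
    have hne' : π (σ a) ≠ π (σ b) := fun hh => hne (π.injective hh)
    rcases lt_or_gt_of_ne hne with hh | hh <;> rcases lt_or_gt_of_ne hne' with hh' | hh' <;>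
      simp [hab, hh, hh.not_gt, hh', hh'.not_gt]
  · simp [hab]

theorem koszulSign_mul_self {p : ℕ} (σ : Perm (Fin p)) (d : Fin p → ℤ) :
    koszulSign σ d * koszulSign σ d = 1 := Int.units_mul_self _

theorem koszulSign_one_degree {p : ℕ} (σ : Perm (Fin p)) :
    koszulSign σ (fun _ => 1) = Perm.sign σ := by
  rw [Perm.sign_eq_prod_prod_Ioi]
  unfold koszulSign
  refine Finset.prod_congr rfl fun a _ => ?_
  rw [← Finset.filter_lt_eq_Ioi, Finset.prod_filter]
  refine Finset.prod_congr rfl fun b _ => ?_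
  by_cases hab : a < b
  · have hne : σ a ≠ σ b := fun hh => hab.ne (σ.injective hh)
    rcases lt_or_gt_of_ne hne with hh | hh
    · simp [hab, hh, hh.not_gt]
    · simp [hab, hh, hh.not_gt]
  · simp [hab]

/-- The shuffle in the coset of `τ` modulo the permutations preserving the blocks. -/
def rep {p : ℕ} (c : Fin p → ℕ) (τ : Perm (Fin p)) : Perm (Fin p) := Tuple.sort (c ∘ τ.symm)

theorem comp_rep {p : ℕ} {c : Fin p → ℕ} (hc : Monotone c) (τ : Perm (Fin p)) :
    c ∘ (τ⁻¹ * rep c τ : Perm (Fin p)) = c := by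
  have h := (Tuple.comp_sort_eq_comp_iff_monotone (f := c ∘ τ.symm) (σ := τ)).2
    (by simpa [Function.comp_assoc] using hc)
  have h2 : (c ∘ τ.symm) ∘ τ = c := by ext; simp
  rw [h2] at h
  conv_rhs => rw [h]
  rfl

theorem rep_mem {p : ℕ} {c : Fin p → ℕ} (hc : Monotone c) (τ : Perm (Fin p)) :
    rep c τ ∈ shuffles c := by
  have h := (Tuple.eq_sort_iff (f := c ∘ τ.symm) (σ := rep c τ)).1 rfl
  have h2 := comp_rep hc τ
  simp only [shuffles, Finset.mem_filter, Finset.mem_univ, true_and]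
  intro i j hij hcij
  refine h.2 i j hij ?_
  have a := congrFun h2 i
  have b := congrFun h2 j
  simp only [Function.comp_apply, Perm.mul_apply] at a b ⊢
  exact a.trans (hcij.trans b.symm)

theorem rep_of_mem {p : ℕ} {c : Fin p → ℕ} (hc : Monotone c) {σ : Perm (Fin p)}
    (h : σ ∈ shuffles c) : rep c σ = σ := by
  simp only [shuffles, Finset.mem_filter, Finset.mem_univ, true_and] at h
  refine ((Tuple.eq_sort_iff (f := c ∘ σ.symm) (σ := σ)).2 ⟨?_, ?_⟩).symm
  · simpa [Function.comp_assoc] using hc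
  · intro i j hij hcij
    exact h i j hij (by simpa using hcij)

theorem rep_mul {p : ℕ} {c : Fin p → ℕ} (σ : Perm (Fin p)) {y : Perm (Fin p)}
    (hy : c ∘ y = c) : rep c (σ * y) = rep c σ := by
  unfold rep
  congr 1
  ext i
  have := congrFun hy (y.symm (σ.symm i))
  simpa [Perm.mul_def] using this.symm

/-- A sum over shuffles of a function which is invariant under block permutations can be
translated. -/
theorem sum_shuffles_mul {p : ℕ} {c : Fin p → ℕ} (hc : Monotone c) {M : Type*} [AddCommMonoid M]
    (F : Perm (Fin p) → M) (hF : ∀ σ y : Perm (Fin p), c ∘ y = c → F (σ * y) = F σ)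
    (π : Perm (Fin p)) :
    ∑ σ ∈ shuffles c, F (π * σ) = ∑ σ ∈ shuffles c, F σ := by
  have key : ∀ π σ : Perm (Fin p), σ ∈ shuffles c → rep c (π⁻¹ * rep c (π * σ)) = σ := by
    intro π σ hσ
    have := rep_mul (c := c) σ (comp_rep hc (π * σ))
    rw [rep_of_mem hc hσ] at this
    have e : π⁻¹ * rep c (π * σ) = σ * ((π * σ)⁻¹ * rep c (π * σ)) := by group
    rw [e, this]
  refine Finset.sum_bij' (fun σ _ => rep c (π * σ)) (fun σ _ => rep c (π⁻¹ * σ))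
    (fun σ _ => rep_mem hc _) (fun σ _ => rep_mem hc _) (fun σ hσ => key π σ hσ)
    (fun σ hσ => by simpa using key π⁻¹ σ hσ) (fun σ _ => ?_)
  have := hF (π * σ) _ (comp_rep hc (π * σ))
  have e : π * σ * ((π * σ)⁻¹ * rep c (π * σ)) = rep c (π * σ) := by group
  rw [e] at this
  exact this.symm

theorem monotone_blocks₂ {p : ℕ} (a : ℕ) : Monotone (blocks₂ a : Fin p → ℕ) := by
  intro i j hij
  have : (i : ℕ) ≤ j := hij
  unfold blocks₂
  split_ifs <;> omega

theorem monotone_blocks₃ {p : ℕ} (a : ℕ) : Monotone (blocks₃ a : Fin p → ℕ) := by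
  intro i j hij
  have : (i : ℕ) ≤ j := hij
  unfold blocks₃
  split_ifs <;> omega

@[to_additive]
theorem prod_split {M : Type*} [CommMonoid M] {l q p : ℕ} (h : l + q = p) (F : Fin p → M) :
    ∏ i, F i = (∏ i : Fin l, F ⟨i, by omega⟩) * ∏ i : Fin q, F ⟨l + i, by omega⟩ := by
  subst h
  rw [Fin.prod_univ_add]
  rfl

/-- A permutation preserving two consecutive blocks restricts to both, and its Koszul sign is the
product of the Koszul signs of the restrictions. -/
theorem exists_restrict {l q p : ℕ} (h : l + q = p) (y : Perm (Fin p))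
    (hy : ∀ i : Fin p, ((i : ℕ) < l ↔ (y i : ℕ) < l)) :
    ∃ (y₁ : Perm (Fin l)) (y₂ : Perm (Fin q)),
      (∀ i : Fin l, y ⟨i, by omega⟩ = ⟨y₁ i, by omega⟩) ∧
      (∀ i : Fin q, y ⟨l + i, by omega⟩ = ⟨l + y₂ i, by omega⟩) ∧
      ∀ d, koszulSign y d = koszulSign y₁ (fun i => d ⟨i, by omega⟩)
        * koszulSign y₂ (fun i => d ⟨l + i, by omega⟩) := by
  have hys : ∀ i : Fin p, ((i : ℕ) < l ↔ (y.symm i : ℕ) < l) := fun i => by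
    simpa using (hy (y.symm i)).symm
  let y₁ : Perm (Fin l) :=
    { toFun := fun i => ⟨y ⟨i, by omega⟩, (hy _).1 i.2⟩
      invFun := fun i => ⟨y.symm ⟨i, by omega⟩, (hys _).1 i.2⟩
      left_inv := fun i => by simp
      right_inv := fun i => by simp }
  have hl : ∀ i : Fin p, ¬ (i : ℕ) < l → l + ((i : ℕ) - l) = i := fun i hi => by omega
  let y₂ : Perm (Fin q) :=
    { toFun := fun i => ⟨y ⟨l + i, by omega⟩ - l, by
        have := (hy ⟨l + i, by omega⟩).not.1 (by simp); omega⟩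
      invFun := fun i => ⟨y.symm ⟨l + i, by omega⟩ - l, by
        have := (hys ⟨l + i, by omega⟩).not.1 (by simp); omega⟩
      left_inv := fun i => by
        have := (hy ⟨l + i, by omega⟩).not.1 (by simp)
        simp [hl _ this]
      right_inv := fun i => by
        have := (hys ⟨l + i, by omega⟩).not.1 (by simp)
        simp [hl _ this] }
  have h1 : ∀ i : Fin l, y ⟨i, by omega⟩ = ⟨y₁ i, by omega⟩ := fun i => rfl
  have h2 : ∀ i : Fin q, y ⟨l + i, by omega⟩ = ⟨l + y₂ i, by omega⟩ := fun i => by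
    have := (hy ⟨l + i, by omega⟩).not.1 (by simp)
    exact Fin.ext (hl _ this).symm
  refine ⟨y₁, y₂, h1, h2, fun d => ?_⟩
  unfold koszulSign
  rw [prod_split h]
  congr 1
  · refine Finset.prod_congr rfl fun a _ => ?_
    rw [prod_split h]
    simp only [h1, h2]
    rw [Finset.prod_eq_one (s := (Finset.univ : Finset (Fin q))), mul_one]
    · rfl
    · intro i _
      rw [if_neg]
      simp only [Fin.mk_lt_mk]
      omega
  · refine Finset.prod_congr rfl fun a _ => ?_
    rw [prod_split h]
    simp only [h1, h2]
    rw [Finset.prod_eq_one (s := (Finset.univ : Finset (Fin l))), one_mul]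
    · simp only [Fin.mk_lt_mk, add_lt_add_iff_left, Fin.val_fin_lt]
    · intro i _
      rw [if_neg]
      simp only [Fin.mk_lt_mk]
      omega

section Terms

variable {K G H : Type*} [Field K] [AddCommGroup G] [Module K G] [AddCommGroup H] [Module K H]

/-- A function of `p` vectors which is linear in each of them is a multilinear map. -/
def mkMultilinear {p : ℕ} (F : (Fin p → H) → G)
    (hF : ∀ v j, ∃ L : H →ₗ[K] G, ∀ x, F (Function.update v j x) = L x) :
    MultilinearMap K (fun _ : Fin p => H) G where
  toFun := F
  map_update_add' := by
    intro inst v j x y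
    obtain ⟨L, hL⟩ := hF v j
    rw [Subsingleton.elim inst (instDecidableEqFin p)]
    simp [hL]
  map_update_smul' := by
    intro inst v j c x
    obtain ⟨L, hL⟩ := hF v j
    rw [Subsingleton.elim inst (instDecidableEqFin p)]
    simp [hL]

/-- The arguments `ρ(g(v_{σ(1)}, …, v_{σ(l)})) v_{σ(l+1)}, v_{σ(l+2)}, …, v_{σ(p)}`. -/
def rhoTuple (ρ : G →ₗ[K] Module.End K H) {l q p : ℕ} (h : l + q = p)
    (g : MultilinearMap K (fun _ : Fin l => H) G) (σ : Perm (Fin p)) (v : Fin p → H) :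
    Fin q → H := fun i =>
  if (i : ℕ) = 0 then ρ (g fun t => v (σ ⟨t, by omega⟩)) (v (σ ⟨l + i, by omega⟩))
  else v (σ ⟨l + i, by omega⟩)

theorem rhoTuple_linear (ρ : G →ₗ[K] Module.End K H) {l q p : ℕ} (h : l + q = p) (hq : 0 < q)
    (f : MultilinearMap K (fun _ : Fin q => H) G)
    (g : MultilinearMap K (fun _ : Fin l => H) G) (σ : Perm (Fin p)) (v : Fin p → H)
    (j : Fin p) :
    ∃ L : H →ₗ[K] G, ∀ x, f (rhoTuple ρ h g σ (Function.update v j x)) = L x := by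
  obtain ⟨t, rfl⟩ := σ.surjective j
  have hu : ∀ (x : H) (s : Fin p),
      Function.update v (σ t) x (σ s) = if s = t then x else v (σ s) := by
    intro x s
    by_cases hs : s = t
    · simp [hs]
    · rw [Function.update_of_ne (fun hh => hs (σ.injective hh)), if_neg hs]
  rcases lt_trichotomy (t : ℕ) l with ht | ht | ht
  · refine ⟨f.toLinearMap (rhoTuple ρ h g σ v) ⟨0, hq⟩ ∘ₗ
      ρ.flip (v (σ ⟨l, by omega⟩)) ∘ₗ
      g.toLinearMap (fun s => v (σ ⟨s, by omega⟩)) ⟨t, ht⟩, fun x => ?_⟩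
    simp only [LinearMap.comp_apply, MultilinearMap.toLinearMap_apply, LinearMap.flip_apply]
    congr 1
    funext i
    have hi : (⟨l + i, by omega⟩ : Fin p) ≠ t := fun hh => by
      have := congrArg Fin.val hh; simp only at this; omega
    by_cases hi0 : (i : ℕ) = 0
    · have : i = ⟨0, hq⟩ := Fin.ext hi0
      subst this
      rw [Function.update_self]
      have hl : (⟨l, by omega⟩ : Fin p) ≠ t := by simpa using hi
      simp only [rhoTuple, if_true, hu, add_zero, if_neg hl]
      congr 2
      refine congrArg g (funext fun s => ?_)
      by_cases hs : s = ⟨t, ht⟩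
      · subst hs; simp
      · rw [Function.update_of_ne hs, if_neg]
        intro hh; exact hs (Fin.ext (by simpa using congrArg Fin.val hh))
    · rw [Function.update_of_ne (fun hh => hi0 (by rw [hh]))]
      simp only [rhoTuple, if_neg hi0, hu, if_neg hi]
  · refine ⟨f.toLinearMap (rhoTuple ρ h g σ v) ⟨0, hq⟩ ∘ₗ
      ρ (g fun s => v (σ ⟨s, by omega⟩)), fun x => ?_⟩
    simp only [LinearMap.comp_apply, MultilinearMap.toLinearMap_apply]
    congr 1
    have hne : ∀ s : Fin l, (⟨s, by omega⟩ : Fin p) ≠ t := fun s hh => by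
      have := congrArg Fin.val hh; simp only at this; omega
    funext i
    by_cases hi0 : (i : ℕ) = 0
    · have : i = ⟨0, hq⟩ := Fin.ext hi0
      subst this
      rw [Function.update_self]
      simp only [rhoTuple, if_true, hu, if_neg (hne _)]
      rw [if_pos (Fin.ext (by simp [ht]))]
    · rw [Function.update_of_ne (fun hh => hi0 (by rw [hh]))]
      simp only [rhoTuple, if_neg hi0, hu]
      rw [if_neg (fun hh => hi0 (by have := congrArg Fin.val hh; simp only at this; omega))]
  · refine ⟨f.toLinearMap (rhoTuple ρ h g σ v) ⟨t - l, by omega⟩, fun x => ?_⟩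
    simp only [MultilinearMap.toLinearMap_apply]
    congr 1
    have hne : ∀ s : Fin l, (⟨s, by omega⟩ : Fin p) ≠ t := fun s hh => by
      have := congrArg Fin.val hh; simp only at this; omega
    funext i
    by_cases hit : i = ⟨t - l, by omega⟩
    · subst hit
      rw [Function.update_self]
      have h0 : (t : ℕ) - l ≠ 0 := by omega
      simp only [rhoTuple, if_neg h0, hu]
      rw [if_pos (Fin.ext (by simp only; omega))]
    · have hi : (⟨l + i, by omega⟩ : Fin p) ≠ t := fun hh => by
        have := congrArg Fin.val hh
        exact hit (Fin.ext (by simp only at this ⊢; omega))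
      rw [Function.update_of_ne hit]
      simp only [rhoTuple, hu, if_neg hi, if_neg (hne _)]

/-- `f(ρ(g(v_{σ(1)}, …, v_{σ(l)})) v_{σ(l+1)}, v_{σ(l+2)}, …, v_{σ(p)})` for `f` of arity `q` and
`g` of arity `l`, `l + q = p`. There is no such expression when `q = 0`. -/
def rhoTerm (ρ : G →ₗ[K] Module.End K H) {l q p : ℕ} (h : l + q = p)
    (f : MultilinearMap K (fun _ : Fin q => H) G)
    (g : MultilinearMap K (fun _ : Fin l => H) G) (σ : Perm (Fin p)) :
    MultilinearMap K (fun _ : Fin p => H) G :=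
  if hq : 0 < q then
    mkMultilinear (fun v => f (rhoTuple ρ h g σ v)) (rhoTuple_linear ρ h hq f g σ)
  else 0

theorem rhoTerm_apply (ρ : G →ₗ[K] Module.End K H) {l q p : ℕ} (h : l + q = p)
    (f : MultilinearMap K (fun _ : Fin q => H) G)
    (g : MultilinearMap K (fun _ : Fin l => H) G) (σ : Perm (Fin p)) (v : Fin p → H) :
    rhoTerm ρ h f g σ v = if 0 < q then f (rhoTuple ρ h g σ v) else 0 := by
  unfold rhoTerm
  split_ifs <;> rfl

/-- `[f(v_{σ(1)}, …, v_{σ(a)}), g(v_{σ(a+1)}, …, v_{σ(p)})]` for `f` of arity `a` and `g` of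
arity `b`, `a + b = p`. -/
def bracketTerm (μ : G →ₗ[K] G →ₗ[K] G) {a b p : ℕ} (h : a + b = p)
    (f : MultilinearMap K (fun _ : Fin a => H) G)
    (g : MultilinearMap K (fun _ : Fin b => H) G) (σ : Perm (Fin p)) :
    MultilinearMap K (fun _ : Fin p => H) G :=
  mkMultilinear
    (fun v => μ (f fun i => v (σ ⟨i, by omega⟩)) (g fun i => v (σ ⟨a + i, by omega⟩))) <| by
  intro v j
  obtain ⟨t, rfl⟩ := σ.surjective j
  have hu : ∀ (x : H) (s : Fin p),
      Function.update v (σ t) x (σ s) = if s = t then x else v (σ s) := by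
    intro x s
    by_cases hs : s = t
    · simp [hs]
    · rw [Function.update_of_ne (fun hh => hs (σ.injective hh)), if_neg hs]
  simp only [hu]
  by_cases ht : (t : ℕ) < a
  · refine ⟨μ.flip (g fun i => v (σ ⟨a + i, by omega⟩)) ∘ₗ
      f.toLinearMap (fun i => v (σ ⟨i, by omega⟩)) ⟨t, ht⟩, fun x => ?_⟩
    simp only [LinearMap.comp_apply, MultilinearMap.toLinearMap_apply, LinearMap.flip_apply]
    congr 2
    · refine congrArg f (funext fun s => ?_)
      by_cases hs : s = ⟨t, ht⟩
      · subst hs; simp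
      · rw [Function.update_of_ne hs, if_neg]
        intro hh; exact hs (Fin.ext (by simpa using congrArg Fin.val hh))
    · refine (funext fun s => ?_)
      rw [if_neg]
      intro hh; have := congrArg Fin.val hh; simp only at this; omega
  · refine ⟨μ (f fun i => v (σ ⟨i, by omega⟩)) ∘ₗ
      g.toLinearMap (fun i => v (σ ⟨a + i, by omega⟩)) ⟨t - a, by omega⟩, fun x => ?_⟩
    simp only [LinearMap.comp_apply, MultilinearMap.toLinearMap_apply]
    congr 2
    · refine congrArg f (funext fun s => ?_)
      rw [if_neg]
      intro hh; have := congrArg Fin.val hh; simp only at this; omega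
    · refine (funext fun s => ?_)
      by_cases hs : s = ⟨t - a, by omega⟩
      · subst hs
        rw [Function.update_self, if_pos (Fin.ext (by simp only; omega))]
      · rw [Function.update_of_ne hs, if_neg]
        intro hh; have := congrArg Fin.val hh
        exact hs (Fin.ext (by simp only at this ⊢; omega))

theorem bracketTerm_apply (μ : G →ₗ[K] G →ₗ[K] G) {a b p : ℕ} (h : a + b = p)
    (f : MultilinearMap K (fun _ : Fin a => H) G)
    (g : MultilinearMap K (fun _ : Fin b => H) G) (σ : Perm (Fin p)) (v : Fin p → H) :
    bracketTerm μ h f g σ v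
      = μ (f fun i => v (σ ⟨i, by omega⟩)) (g fun i => v (σ ⟨a + i, by omega⟩)) := rfl

/-- The `s`-th (counting from `0`) natural number different from `i` and `j`, for `i < j`. -/
def skip (i j s : ℕ) : ℕ := if s < i then s else if s + 1 < j then s + 1 else s + 2

theorem skip_lt {i j s p : ℕ} (hs : s + 2 < p) : skip i j s < p := by
  unfold skip; split_ifs <;> omega

theorem skip_lt' {r p : ℕ} (h : r + 1 = p) {i j : Fin p} (_ : i < j) (t : Fin r)
    (ht : (t : ℕ) ≠ 0) : skip i j (t - 1) < p := skip_lt (by omega)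

/-- `g(λ[v_i, v_j], v_1, …, v̂_i, …, v̂_j, …, v_p)` for `i < j` and `g` of arity `r = p - 1`. -/
def diffTerm (lam : K) (μ : H →ₗ[K] H →ₗ[K] H) {r p : ℕ} (h : r + 1 = p)
    (g : MultilinearMap K (fun _ : Fin r => H) G) {i j : Fin p} (hij : i < j) :
    MultilinearMap K (fun _ : Fin p => H) G :=
  mkMultilinear (fun v => g fun t =>
    if ht : (t : ℕ) = 0 then lam • μ (v i) (v j) else v ⟨skip i j (t - 1), skip_lt' h hij t ht⟩) <| by
  intro v k
  have hij' : (i : ℕ) < j := hij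
  have hr : 0 < r := by omega
  set u : (Fin p → H) → Fin r → H := fun v t =>
    if ht : (t : ℕ) = 0 then lam • μ (v i) (v j) else v ⟨skip i j (t - 1), skip_lt' h hij t ht⟩
    with hu
  have hsi : ∀ s, skip i j s ≠ i := fun s => by unfold skip; split_ifs <;> omega
  have hsj : ∀ s, skip i j s ≠ j := fun s => by unfold skip; split_ifs <;> omega
  by_cases hki : k = i
  · subst hki
    refine ⟨g.toLinearMap (u v) ⟨0, hr⟩ ∘ₗ (lam • μ.flip (v j)), fun x => ?_⟩
    simp only [LinearMap.comp_apply, MultilinearMap.toLinearMap_apply]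
    congr 1
    funext t
    by_cases ht : (t : ℕ) = 0
    · obtain rfl : t = ⟨0, hr⟩ := Fin.ext ht
      simp [hu, hij.ne']
    · rw [Function.update_of_ne (show t ≠ ⟨0, hr⟩ from fun hh => ht (by rw [hh]))]
      simp only [hu, dif_neg ht]
      rw [Function.update_of_ne (fun hh => hsi _ (congrArg Fin.val hh))]
  by_cases hkj : k = j
  · subst hkj
    refine ⟨g.toLinearMap (u v) ⟨0, hr⟩ ∘ₗ (lam • μ (v i)), fun x => ?_⟩
    simp only [LinearMap.comp_apply, MultilinearMap.toLinearMap_apply]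
    congr 1
    funext t
    by_cases ht : (t : ℕ) = 0
    · obtain rfl : t = ⟨0, hr⟩ := Fin.ext ht
      simp [hu, hij.ne]
    · rw [Function.update_of_ne (show t ≠ ⟨0, hr⟩ from fun hh => ht (by rw [hh]))]
      simp only [hu, dif_neg ht]
      rw [Function.update_of_ne (fun hh => hsj _ (congrArg Fin.val hh))]
  have hki' : (k : ℕ) ≠ i := fun hh => hki (Fin.ext hh)
  have hkj' : (k : ℕ) ≠ j := fun hh => hkj (Fin.ext hh)
  obtain ⟨s, hs, hsr⟩ : ∃ s, skip i j s = k ∧ s + 2 < p := by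
    rcases lt_or_ge (k : ℕ) i with h1 | h1
    · exact ⟨k, by unfold skip; split_ifs <;> omega, by omega⟩
    rcases lt_or_ge (k : ℕ) j with h2 | h2
    · exact ⟨k - 1, by unfold skip; split_ifs <;> omega, by omega⟩
    · exact ⟨k - 2, by unfold skip; split_ifs <;> omega, by omega⟩
  refine ⟨g.toLinearMap (u v) ⟨s + 1, by omega⟩, fun x => ?_⟩
  simp only [MultilinearMap.toLinearMap_apply]
  congr 1
  funext t
  by_cases ht : (t : ℕ) = 0
  · obtain rfl : t = ⟨0, hr⟩ := Fin.ext ht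
    rw [Function.update_of_ne (show (⟨0, hr⟩ : Fin r) ≠ ⟨s + 1, by omega⟩ by simp [Fin.ext_iff])]
    simp [hu, Ne.symm hki, Ne.symm hkj]
  · by_cases hts : t = ⟨s + 1, by omega⟩
    · subst hts
      rw [Function.update_self]
      simp only [hu]
      rw [dif_neg (by simp)]
      simp [hs]
    · rw [Function.update_of_ne hts]
      simp only [hu, dif_neg ht]
      rw [Function.update_of_ne]
      intro hh
      have hh' := congrArg Fin.val hh
      apply hts
      apply Fin.ext
      simp only at hh' ⊢
      rw [← hs] at hh'
      revert hh'
      unfold skip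
      split_ifs <;> omega

theorem diffTerm_apply (lam : K) (μ : H →ₗ[K] H →ₗ[K] H) {r p : ℕ} (h : r + 1 = p)
    (g : MultilinearMap K (fun _ : Fin r => H) G) {i j : Fin p} (hij : i < j) (v : Fin p → H) :
    diffTerm lam μ h g hij v = g fun t =>
      if ht : (t : ℕ) = 0 then lam • μ (v i) (v j)
      else v ⟨skip i j (t - 1), skip_lt' h hij t ht⟩ := rfl

end Terms

section Graded

variable {K G H : Type*} [Field K] [AddCommGroup G] [Module K G] [AddCommGroup H] [Module K H]
variable (𝒢 : ℤ → Submodule K G) (ℋ : ℤ → Submodule K H)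

/-- A symmetric graded Lie algebra structure on the graded vector space `G = ⨁ 𝒢 i`: a bilinear
bracket of degree `1` which is graded symmetric and satisfies the graded Leibniz rule. -/
structure SymmGradedLie where
  bracket : G →ₗ[K] G →ₗ[K] G
  bracket_mem : ∀ {i j : ℤ} {x y : G}, x ∈ 𝒢 i → y ∈ 𝒢 j → bracket x y ∈ 𝒢 (i + j + 1)
  bracket_symm : ∀ {i j : ℤ} {x y : G}, x ∈ 𝒢 i → y ∈ 𝒢 j →
    bracket x y = (i * j).negOnePow • bracket y x
  leibniz : ∀ {i j k : ℤ} {x y z : G}, x ∈ 𝒢 i → y ∈ 𝒢 j → z ∈ 𝒢 k →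
    bracket x (bracket y z) = (i + 1).negOnePow • bracket (bracket x y) z
      + ((i + 1) * (j + 1)).negOnePow • bracket y (bracket x z)

variable {𝒢 ℋ}

/-- Derivations of degree `n` of a symmetric graded Lie algebra. -/
structure IsDerivation (L : SymmGradedLie ℋ) (n : ℤ) (D : Module.End K H) : Prop where
  map_mem : ∀ {i : ℤ} {x : H}, x ∈ ℋ i → D x ∈ ℋ (i + n)
  leibniz : ∀ {i j : ℤ} {x y : H}, x ∈ ℋ i → y ∈ ℋ j →
    D (L.bracket x y) = n.negOnePow • L.bracket (D x) y
      + (n * (i + 1)).negOnePow • L.bracket x (D y)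

/-- The graded commutator of endomorphisms of degrees `m` and `n`. -/
def gradedCommutator (m n : ℤ) (f g : Module.End K H) : Module.End K H :=
  f * g - (m * n).negOnePow • (g * f)

/-- An action of a symmetric graded Lie algebra `𝔤` on a symmetric graded Lie algebra `𝔥`: a linear
map `ρ : 𝔤 → Der(𝔥)` of degree `1` such that `s⁻¹ ∘ ρ` is a homomorphism to `s⁻¹ Der(𝔥)`, whose
bracket is `[s⁻¹ f, s⁻¹ g] = (-1)^m s⁻¹ [f, g]` for `f` of degree `m`. -/
structure SymmGradedLieAction (𝔤 : SymmGradedLie 𝒢) (𝔥 : SymmGradedLie ℋ) where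
  toFun : G →ₗ[K] Module.End K H
  isDerivation : ∀ {i : ℤ} {x : G}, x ∈ 𝒢 i → IsDerivation 𝔥 (i + 1) (toFun x)
  map_bracket : ∀ {i j : ℤ} {x y : G}, x ∈ 𝒢 i → y ∈ 𝒢 j →
    toFun (𝔤.bracket x y)
      = (i + 1).negOnePow • gradedCommutator (i + 1) (j + 1) (toFun x) (toFun y)

variable (𝒢 ℋ)

/-- The multilinear maps `Hᵖ → G` which correspond to the linear maps `Sᵖ(H) → G` of degree `n`:
they are graded symmetric, `f(v₁, …, v_p) = ε(σ; v₁, …, v_p) f(v_{σ(1)}, …, v_{σ(p)})`, and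
homogeneous of degree `n`. -/
structure IsGradedSymm (n : ℤ) {p : ℕ} (f : MultilinearMap K (fun _ : Fin p => H) G) : Prop where
  map_mem : ∀ (d : Fin p → ℤ) (v : Fin p → H), (∀ i, v i ∈ ℋ (d i)) → f v ∈ 𝒢 (∑ i, d i + n)
  symm : ∀ (d : Fin p → ℤ) (v : Fin p → H), (∀ i, v i ∈ ℋ (d i)) →
    ∀ σ : Perm (Fin p), f v = koszulSign σ d • f (v ∘ σ)

theorem units_smul_mem {V : Type*} [AddCommGroup V] [Module K V] (W : Submodule K V) (u : ℤˣ)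
    {x : V} (h : x ∈ W) : u • x ∈ W := by
  rcases Int.units_eq_one_or u with rfl | rfl
  · simpa using h
  · simpa [Units.neg_smul] using h

/-- `Homⁿ(S(H), G)`, the space of families `f = ∑ f_p` with `f_p : Sᵖ(H) → G` of degree `n`. -/
def gradedHom (n : ℤ) : Submodule K (∀ p : ℕ, MultilinearMap K (fun _ : Fin p => H) G) where
  carrier := {f | ∀ p, IsGradedSymm 𝒢 ℋ n (f p)}
  zero_mem' p := ⟨fun _ _ _ => by simp, fun _ _ _ _ => by simp⟩
  add_mem' {f g} hf hg p := ⟨fun d v h => by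
      simpa using (𝒢 _).add_mem ((hf p).map_mem d v h) ((hg p).map_mem d v h),
    fun d v h σ => by
      simp only [Pi.add_apply, _root_.add_apply, smul_add]
      rw [← (hf p).symm d v h σ, ← (hg p).symm d v h σ]⟩
  smul_mem' c f hf p := ⟨fun d v h => by
      simpa using (𝒢 _).smul_mem c ((hf p).map_mem d v h),
    fun d v h σ => by
      simp only [Pi.smul_apply, _root_.smul_apply]
      rw [smul_comm, ← (hf p).symm d v h σ]⟩

variable [DirectSum.Decomposition ℋ]

/-- The multilinear map on `H = ⨁ ℋ i` which is given by `F d` on tuples of homogeneous elements of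
degrees `d`. -/
noncomputable def extend {p : ℕ} (F : (Fin p → ℤ) → MultilinearMap K (fun _ : Fin p => H) G) :
    MultilinearMap K (fun _ : Fin p => H) G :=
  (MultilinearMap.fromDirectSumEquiv (R := K) (κ := fun _ : Fin p => ℤ)
    (M := fun _ i => ℋ i) (M' := G)
    (fun d => (F d).compLinearMap fun i => (ℋ (d i)).subtype)).compLinearMap
    fun _ => (DirectSum.decomposeLinearEquiv ℋ).toLinearMap

theorem extend_apply {p : ℕ} (F : (Fin p → ℤ) → MultilinearMap K (fun _ : Fin p => H) G)
    (d : Fin p → ℤ) (v : Fin p → H) (h : ∀ i, v i ∈ ℋ (d i)) : extend ℋ F v = F d v := by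
  have key := MultilinearMap.fromDirectSumEquiv_lof (R := K) (κ := fun _ : Fin p => ℤ)
    (M := fun _ i => ℋ i)
    (fun d => (F d).compLinearMap fun i => (ℋ (d i)).subtype) d (fun i => ⟨v i, h i⟩)
  unfold extend
  rw [MultilinearMap.compLinearMap_apply]
  have e : (fun i => (DirectSum.decomposeLinearEquiv ℋ).toLinearMap (v i))
      = fun i => DirectSum.lof K ℤ (fun i => ℋ i) (d i) ⟨v i, h i⟩ := by
    funext i
    exact DirectSum.decompose_of_mem ℋ (h i)
  rw [e]
  refine Eq.trans ?_ (key.trans ?_)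
  · rfl
  · rfl

end Graded

/-- A sum over shuffles with Koszul signs is graded symmetric if its terms are graded symmetric
under block permutations. -/
theorem sum_shuffles_symm {p : ℕ} {c : Fin p → ℕ} (hc : Monotone c)
    {H G : Type*} [AddCommGroup G] (F : (Fin p → ℤ) → (Fin p → H) → G)
    (d : Fin p → ℤ) (v : Fin p → H)
    (hF : ∀ τ y : Perm (Fin p), c ∘ y = c →
      koszulSign y (d ∘ τ) • F ((d ∘ τ) ∘ y) ((v ∘ τ) ∘ y) = F (d ∘ τ) (v ∘ τ))
    (π : Perm (Fin p)) :
    koszulSign π d • ∑ σ ∈ shuffles c, koszulSign σ (d ∘ π) • F ((d ∘ π) ∘ σ) ((v ∘ π) ∘ σ)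
      = ∑ σ ∈ shuffles c, koszulSign σ d • F (d ∘ σ) (v ∘ σ) := by
  rw [← sum_shuffles_mul hc (fun σ => koszulSign σ d • F (d ∘ σ) (v ∘ σ)) ?_ π, Finset.smul_sum]
  · refine Finset.sum_congr rfl fun σ _ => ?_
    rw [koszulSign_mul, mul_smul]
    rfl
  · intro σ y hy
    rw [koszulSign_mul, mul_smul]
    congr 1
    exact hF σ y hy

theorem blocks₂_comp {p a : ℕ} {y : Perm (Fin p)} (h : blocks₂ a ∘ y = blocks₂ a) (i : Fin p) :
    (i : ℕ) < a ↔ (y i : ℕ) < a := by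
  have := congrFun h i
  simp only [Function.comp_apply, blocks₂] at this
  split_ifs at this <;> omega

theorem blocks₃_comp {p a : ℕ} {y : Perm (Fin p)} (h : blocks₃ a ∘ y = blocks₃ a) (i : Fin p) :
    ((i : ℕ) < a ↔ (y i : ℕ) < a) ∧ ((i : ℕ) = a ↔ (y i : ℕ) = a) := by
  have := congrFun h i
  simp only [Function.comp_apply, blocks₃] at this
  split_ifs at this <;> omega

section Symmetry

variable {K G H : Type*} [Field K] [AddCommGroup G] [Module K G] [AddCommGroup H] [Module K H]
variable {𝒢 : ℤ → Submodule K G} {ℋ : ℤ → Submodule K H}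

theorem isGradedSymm_extend [DirectSum.Decomposition ℋ] {n : ℤ} {p : ℕ}
    (F : (Fin p → ℤ) → MultilinearMap K (fun _ : Fin p => H) G)
    (h₁ : ∀ d v, (∀ i, v i ∈ ℋ (d i)) → F d v ∈ 𝒢 (∑ i, d i + n))
    (h₂ : ∀ d v, (∀ i, v i ∈ ℋ (d i)) → ∀ σ : Perm (Fin p),
      koszulSign σ d • F (d ∘ σ) (v ∘ σ) = F d v) :
    IsGradedSymm 𝒢 ℋ n (extend ℋ F) where
  map_mem d v h := by rw [extend_apply ℋ F d v h]; exact h₁ d v h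
  symm d v h σ := by
    rw [extend_apply ℋ F d v h, extend_apply ℋ F (d ∘ σ) (v ∘ σ) (fun i => h (σ i)), h₂ d v h]

theorem bracketTerm_symm (μ : G →ₗ[K] G →ₗ[K] G) {a b p : ℕ} (h : a + b = p) {m n : ℤ}
    {f : MultilinearMap K (fun _ : Fin a => H) G} {g : MultilinearMap K (fun _ : Fin b => H) G}
    (hf : IsGradedSymm 𝒢 ℋ m f) (hg : IsGradedSymm 𝒢 ℋ n g)
    (d : Fin p → ℤ) (v : Fin p → H) (hv : ∀ i, v i ∈ ℋ (d i)) (y : Perm (Fin p))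
    (hy : blocks₂ a ∘ y = blocks₂ a) :
    koszulSign y d • bracketTerm μ h f g 1 (v ∘ y) = bracketTerm μ h f g 1 v := by
  obtain ⟨y₁, y₂, h₁, h₂, hs⟩ := exists_restrict h y (blocks₂_comp hy)
  simp only [bracketTerm_apply, Perm.coe_one, id, Function.comp_apply, h₁, h₂]
  rw [hs, hf.symm _ (fun i => v ⟨i, by omega⟩) (fun i => hv _) y₁,
    hg.symm _ (fun i => v ⟨a + i, by omega⟩) (fun i => hv _) y₂]
  simp only [Units.smul_def, map_zsmul, LinearMap.smul_apply, smul_smul, Units.val_mul]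
  rw [mul_comm]
  rfl

theorem bracketTerm_eq (μ : G →ₗ[K] G →ₗ[K] G) {a b p : ℕ} (h : a + b = p)
    (f : MultilinearMap K (fun _ : Fin a => H) G) (g : MultilinearMap K (fun _ : Fin b => H) G)
    (σ : Perm (Fin p)) (v : Fin p → H) :
    bracketTerm μ h f g σ v = bracketTerm μ h f g 1 (v ∘ σ) := rfl

theorem bracketTerm_mem (μ : G →ₗ[K] G →ₗ[K] G)
    (hμ : ∀ {i j : ℤ} {x y : G}, x ∈ 𝒢 i → y ∈ 𝒢 j → μ x y ∈ 𝒢 (i + j + 1))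
    {a b p : ℕ} (h : a + b = p) {m n : ℤ}
    {f : MultilinearMap K (fun _ : Fin a => H) G} {g : MultilinearMap K (fun _ : Fin b => H) G}
    (hf : IsGradedSymm 𝒢 ℋ m f) (hg : IsGradedSymm 𝒢 ℋ n g)
    (d : Fin p → ℤ) (v : Fin p → H) (hv : ∀ i, v i ∈ ℋ (d i)) (σ : Perm (Fin p)) :
    bracketTerm μ h f g σ v ∈ 𝒢 (∑ i, d i + (m + n + 1)) := by
  have := hμ (hf.map_mem _ (fun i => v (σ ⟨i, by omega⟩)) (fun i => hv _))
    (hg.map_mem _ (fun i => v (σ ⟨a + i, by omega⟩)) (fun i => hv _))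
  rw [bracketTerm_apply]
  convert this using 2
  rw [← Equiv.sum_comp σ d, sum_split h]
  ring

theorem rhoTuple_zero (ρ : G →ₗ[K] Module.End K H) {l q p : ℕ} (h : l + q = p) (hq : 0 < q)
    (g : MultilinearMap K (fun _ : Fin l => H) G) (v : Fin p → H) :
    rhoTuple ρ h g 1 v ⟨0, hq⟩ = ρ (g fun t => v ⟨t, by omega⟩) (v ⟨l, by omega⟩) := by
  simp [rhoTuple]

theorem rhoTuple_ne_zero (ρ : G →ₗ[K] Module.End K H) {l q p : ℕ} (h : l + q = p)
    (g : MultilinearMap K (fun _ : Fin l => H) G) (v : Fin p → H) (i : Fin q) (hi : (i : ℕ) ≠ 0) :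
    rhoTuple ρ h g 1 v i = v ⟨l + i, by omega⟩ := by
  simp [rhoTuple, hi]

/-- The degrees of the entries of `rhoTuple`. -/
def rhoDegrees {l q p : ℕ} (h : l + q = p) (n : ℤ) (d : Fin p → ℤ) (i : Fin q) : ℤ :=
  d ⟨l + i, by omega⟩ + if (i : ℕ) = 0 then (∑ t : Fin l, d ⟨t, by omega⟩) + n + 1 else 0

theorem rhoTuple_mem (ρ : G →ₗ[K] Module.End K H)
    (hρ : ∀ {i j : ℤ} {x : G} {y : H}, x ∈ 𝒢 i → y ∈ ℋ j → ρ x y ∈ ℋ (j + (i + 1)))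
    {l q p : ℕ} (h : l + q = p) {n : ℤ} {g : MultilinearMap K (fun _ : Fin l => H) G}
    (hg : IsGradedSymm 𝒢 ℋ n g)
    (d : Fin p → ℤ) (v : Fin p → H) (hv : ∀ i, v i ∈ ℋ (d i)) (i : Fin q) :
    rhoTuple ρ h g 1 v i ∈ ℋ (rhoDegrees h n d i) := by
  by_cases hi : (i : ℕ) = 0
  · have hq : 0 < q := by omega
    obtain rfl : i = ⟨0, hq⟩ := Fin.ext hi
    rw [rhoTuple_zero]
    have := hρ (hg.map_mem _ (fun t => v ⟨t, by omega⟩) (fun i => hv _)) (hv ⟨l, by omega⟩)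
    simpa [rhoDegrees] using this
  · rw [rhoTuple_ne_zero _ _ _ _ _ hi]
    simpa [rhoDegrees, hi] using hv _

theorem koszulSign_congr_of_fix {q : ℕ} (y : Perm (Fin q)) (d e : Fin q → ℤ)
    (hy : ∀ i : Fin q, (i : ℕ) = 0 → y i = i) (hde : ∀ i : Fin q, (i : ℕ) ≠ 0 → d i = e i) :
    koszulSign y d = koszulSign y e := by
  unfold koszulSign
  refine Finset.prod_congr rfl fun a _ => Finset.prod_congr rfl fun b _ => ?_
  by_cases hab : a < b ∧ y b < y a
  · have h1 : (y a : ℕ) ≠ 0 := by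
      have : (y b : ℕ) < y a := hab.2
      omega
    have h2 : (y b : ℕ) ≠ 0 := fun h2 => by
      have hb : y b = b := y.injective (hy (y b) h2)
      have : (a : ℕ) < b := hab.1
      rw [hb] at h2
      omega
    rw [hde _ h1, hde _ h2]
  · simp [hab]

theorem rhoTerm_symm (ρ : G →ₗ[K] Module.End K H)
    (hρ : ∀ {i j : ℤ} {x : G} {y : H}, x ∈ 𝒢 i → y ∈ ℋ j → ρ x y ∈ ℋ (j + (i + 1)))
    {l q p : ℕ} (h : l + q = p) {m n : ℤ}
    {f : MultilinearMap K (fun _ : Fin q => H) G} {g : MultilinearMap K (fun _ : Fin l => H) G}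
    (hf : IsGradedSymm 𝒢 ℋ m f) (hg : IsGradedSymm 𝒢 ℋ n g)
    (d : Fin p → ℤ) (v : Fin p → H) (hv : ∀ i, v i ∈ ℋ (d i)) (y : Perm (Fin p))
    (hy : blocks₃ l ∘ y = blocks₃ l) :
    koszulSign y d • rhoTerm ρ h f g 1 (v ∘ y) = rhoTerm ρ h f g 1 v := by
  rw [rhoTerm_apply, rhoTerm_apply]
  by_cases hq : 0 < q
  swap
  · simp [hq]
  rw [if_pos hq, if_pos hq]
  obtain ⟨y₁, y₂, h₁, h₂, hs⟩ := exists_restrict h y (fun i => (blocks₃_comp hy i).1)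
  have hy₂ : ∀ i : Fin q, (i : ℕ) = 0 → y₂ i = i := by
    intro i hi
    have := (blocks₃_comp hy ⟨l + i, by omega⟩).2
    rw [h₂] at this
    apply Fin.ext
    have h3 := this.1 (by simp [hi])
    simp only at h3
    omega
  have e : rhoTuple ρ h g 1 (v ∘ y) = Function.update (rhoTuple ρ h g 1 v ∘ y₂) ⟨0, hq⟩
      (((koszulSign y₁ fun i => d ⟨i, by omega⟩ : ℤˣ) : ℤ) • rhoTuple ρ h g 1 v ⟨0, hq⟩) := by
    funext i
    by_cases hi : (i : ℕ) = 0
    · obtain rfl : i = ⟨0, hq⟩ := Fin.ext hi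
      rw [Function.update_self, rhoTuple_zero, rhoTuple_zero]
      have hl : y ⟨l, by omega⟩ = ⟨l, by omega⟩ := by
        have := h₂ ⟨0, hq⟩
        simp only [hy₂ ⟨0, hq⟩ rfl] at this
        simpa using this
      simp only [Function.comp_apply, h₁, hl]
      rw [hg.symm _ (fun t => v ⟨t, by omega⟩) (fun i => hv _) y₁, ← Units.smul_def,
        Units.smul_def, Units.smul_def, map_zsmul, LinearMap.smul_apply, smul_smul,
        ← Units.val_mul, koszulSign_mul_self]
      simp [Function.comp_def]
    · have hyi : (y₂ i : ℕ) ≠ 0 := fun hh => hi (by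
        rw [← y₂.injective (hy₂ _ hh)]; exact hh)
      rw [Function.update_of_ne (fun hh => hi (by rw [hh])), rhoTuple_ne_zero _ _ _ _ _ hi,
        Function.comp_apply, Function.comp_apply, rhoTuple_ne_zero _ _ _ _ _ hyi, h₂]
  have e2 : Function.update (rhoTuple ρ h g 1 v ∘ y₂) ⟨0, hq⟩ (rhoTuple ρ h g 1 v ⟨0, hq⟩)
      = rhoTuple ρ h g 1 v ∘ y₂ := by
    rw [Function.update_eq_self_iff, Function.comp_apply, hy₂ _ rfl]
  have e3 := hf.symm _ _ (rhoTuple_mem ρ hρ h hg d v hv) y₂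
  have e4 : koszulSign y₂ (rhoDegrees h n d) = koszulSign y₂ (fun i => d ⟨l + i, by omega⟩) :=
    koszulSign_congr_of_fix _ _ _ hy₂ fun i hi => by simp [rhoDegrees, hi]
  have e5 : ∀ (z : ℤ), f (Function.update (rhoTuple ρ h g 1 v ∘ y₂) ⟨0, hq⟩
      (z • rhoTuple ρ h g 1 v ⟨0, hq⟩)) = z • f (rhoTuple ρ h g 1 v ∘ y₂) := by
    intro z
    rw [← Int.cast_smul_eq_zsmul K, f.map_update_smul, e2, Int.cast_smul_eq_zsmul]
  rw [e, e5, e3, e4, hs, Units.smul_def, Units.smul_def, smul_smul]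
  congr 1
  rw [← Units.val_mul, mul_right_comm, koszulSign_mul_self, one_mul]

theorem rhoTerm_eq (ρ : G →ₗ[K] Module.End K H) {l q p : ℕ} (h : l + q = p)
    (f : MultilinearMap K (fun _ : Fin q => H) G) (g : MultilinearMap K (fun _ : Fin l => H) G)
    (σ : Perm (Fin p)) (v : Fin p → H) :
    rhoTerm ρ h f g σ v = rhoTerm ρ h f g 1 (v ∘ σ) := by
  rw [rhoTerm_apply, rhoTerm_apply]
  rfl

theorem rhoTerm_mem (ρ : G →ₗ[K] Module.End K H)
    (hρ : ∀ {i j : ℤ} {x : G} {y : H}, x ∈ 𝒢 i → y ∈ ℋ j → ρ x y ∈ ℋ (j + (i + 1)))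
    {l q p : ℕ} (h : l + q = p) {m n : ℤ}
    {f : MultilinearMap K (fun _ : Fin q => H) G} {g : MultilinearMap K (fun _ : Fin l => H) G}
    (hf : IsGradedSymm 𝒢 ℋ m f) (hg : IsGradedSymm 𝒢 ℋ n g)
    (d : Fin p → ℤ) (v : Fin p → H) (hv : ∀ i, v i ∈ ℋ (d i)) (σ : Perm (Fin p)) :
    rhoTerm ρ h f g σ v ∈ 𝒢 (∑ i, d i + (m + n + 1)) := by
  rw [rhoTerm_eq, rhoTerm_apply]
  split_ifs with hq
  swap
  · simp
  have := hf.map_mem _ _ (rhoTuple_mem ρ hρ h hg (d ∘ σ) (v ∘ σ) (fun i => hv _))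
  convert this using 2
  rw [← Equiv.sum_comp σ d, sum_split h]
  unfold rhoDegrees
  rw [Finset.sum_add_distrib, Finset.sum_eq_single (⟨0, hq⟩ : Fin q)
    (f := fun i : Fin q => if (i : ℕ) = 0 then _ else _)]
  · simp only [if_true, Function.comp_apply]
    ring
  · intro i _ hi
    rw [if_neg (fun hh => hi (Fin.ext hh))]
  · simp

end Symmetry

section Differential

variable {K G H : Type*} [Field K] [AddCommGroup G] [Module K G] [AddCommGroup H] [Module K H]
variable {𝒢 : ℤ → Submodule K G} {ℋ : ℤ → Submodule K H}

/-- The `(2, p - 2)`-shuffle with `σ(1) = i` and `σ(2) = j`. -/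
theorem exists_shuffle {p : ℕ} {i j : Fin p} (hij : i < j) :
    ∃ σ : Perm (Fin p), σ ∈ shuffles (blocks₂ 2) ∧
      (∀ t : Fin p, (σ t : ℕ) = if (t : ℕ) = 0 then (i : ℕ) else if (t : ℕ) = 1 then (j : ℕ)
        else skip i j (t - 2)) := by
  have hij' : (i : ℕ) < j := hij
  let u : Fin p → Fin p := fun t => ⟨if (t : ℕ) = 0 then (i : ℕ) else if (t : ℕ) = 1 then (j : ℕ)
        else skip i j (t - 2), by
    split_ifs
    · exact i.2
    · exact j.2
    · exact skip_lt (by omega)⟩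
  have hu : Function.Injective u := by
    intro a b hab
    have := congrArg Fin.val hab
    simp only [u, skip] at this
    apply Fin.ext
    split_ifs at this <;> omega
  refine ⟨Equiv.ofBijective u (Finite.injective_iff_bijective.1 hu), ?_, fun t => rfl⟩
  rw [mem_shuffles]
  intro a b hab hc
  simp only [blocks₂] at hc
  have hab' : (a : ℕ) < b := hab
  change (u a : ℕ) < u b
  simp only [u, skip]
  split_ifs at hc ⊢ <;> omega

theorem shuffle_ext {p : ℕ} {σ τ : Perm (Fin p)} (hσ : σ ∈ shuffles (blocks₂ 2))
    (hτ : τ ∈ shuffles (blocks₂ 2)) (h : ∀ t : Fin p, (t : ℕ) < 2 → σ t = τ t) : σ = τ := by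
  have hc : blocks₂ 2 ∘ (σ⁻¹ * τ : Perm (Fin p)) = blocks₂ 2 := by
    have h1 : ∀ t : Fin p, (t : ℕ) < 2 → (σ⁻¹ * τ : Perm (Fin p)) t = t := by
      intro t ht
      rw [Perm.mul_apply, ← h t ht, ← Perm.mul_apply, inv_mul_cancel, Perm.one_apply]
    funext t
    by_cases ht : (t : ℕ) < 2
    · rw [Function.comp_apply, h1 t ht]
    · have : ¬ (((σ⁻¹ * τ : Perm (Fin p)) t : Fin p) : ℕ) < 2 := by
        intro h2
        have := (σ⁻¹ * τ : Perm (Fin p)).injective (h1 _ h2)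
        rw [this] at h2
        exact ht h2
      simp [blocks₂, ht] at this ⊢
      omega
  have := rep_mul σ hc
  rw [mul_inv_cancel_left, rep_of_mem (monotone_blocks₂ 2) hτ,
    rep_of_mem (monotone_blocks₂ 2) hσ] at this
  exact this.symm

theorem negOnePow_sum {ι : Type*} (s : Finset ι) (f : ι → ℤ) :
    (∑ i ∈ s, f i).negOnePow = ∏ i ∈ s, (f i).negOnePow := by
  classical
  induction s using Finset.induction_on with
  | empty => rfl
  | insert a s ha ih => rw [Finset.sum_insert ha, Finset.prod_insert ha, Int.negOnePow_add, ih]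

theorem koszulSign_shuffle {p : ℕ} {i j : Fin p} (hij : i < j) {σ : Perm (Fin p)}
    (hσ : σ ∈ shuffles (blocks₂ 2)) (h0 : ∀ t : Fin p, (t : ℕ) = 0 → σ t = i)
    (h1 : ∀ t : Fin p, (t : ℕ) = 1 → σ t = j) (d : Fin p → ℤ) :
    koszulSign σ d = (d i * (∑ r ∈ Finset.Iio i, d r) + d j * (∑ r ∈ Finset.Iio j, d r)
      + d i * d j).negOnePow := by
  have hij' : (i : ℕ) < j := hij
  have hp : 2 ≤ p := by omega
  rw [mem_shuffles] at hσ
  obtain ⟨q, rfl⟩ : ∃ q, p = q + 2 := ⟨p - 2, by omega⟩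
  have h0' : σ 0 = i := h0 _ rfl
  have h1' : σ 1 = j := h1 _ rfl
  have key : ∀ P : Fin (q + 2) → ℤˣ, (∀ a : Fin q, P a.succ.succ = 1) → ∏ a, P a = P 0 * P 1 := by
    intro P hP
    rw [Fin.prod_univ_succ, Fin.prod_univ_succ]
    simp [hP]
  unfold koszulSign
  rw [key]
  swap
  · intro a
    refine Finset.prod_eq_one fun b _ => ?_
    rw [if_neg]
    rintro ⟨hab, hs⟩
    have hab' : ((a.succ.succ : Fin (q + 2)) : ℕ) < b := hab
    simp only [Fin.val_succ] at hab'
    refine absurd (hσ a.succ.succ b hab ?_) hs.not_gt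
    simp only [blocks₂, Fin.val_succ]
    rw [if_neg (by omega), if_neg (by omega)]
  have e0 : (∏ b : Fin (q + 2), if (0 : Fin (q + 2)) < b ∧ σ b < σ 0
      then (d (σ 0) * d (σ b)).negOnePow else 1) = (d i * ∑ r ∈ Finset.Iio i, d r).negOnePow := by
    rw [Finset.mul_sum, negOnePow_sum, ← Finset.filter_gt_eq_Iio, Finset.prod_filter]
    conv_rhs => rw [← Equiv.prod_comp σ]
    refine Finset.prod_congr rfl fun b _ => ?_
    rw [h0']
    by_cases hb : σ b < i
    · have hpos : 0 < b := Fin.pos_iff_ne_zero.2 fun hb0 => by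
        rw [hb0, h0'] at hb
        exact lt_irrefl _ hb
      rw [if_pos hb, if_pos ⟨hpos, hb⟩]
    · rw [if_neg hb, if_neg (fun hh => hb hh.2)]
  have e1 : (∏ b : Fin (q + 2), if (1 : Fin (q + 2)) < b ∧ σ b < σ 1
      then (d (σ 1) * d (σ b)).negOnePow else 1)
      = (d j * (∑ r ∈ Finset.Iio j, d r) + d i * d j).negOnePow := by
    have e2 : d j * (∑ r ∈ Finset.Iio j, d r) + d i * d j
        = (∑ r ∈ (Finset.Iio j).erase i, d j * d r) + 2 * (d i * d j) := by
      rw [Finset.mul_sum, ← Finset.sum_erase_add _ _ (Finset.mem_Iio.2 hij)]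
      ring
    rw [e2, Int.negOnePow_add, Int.negOnePow_two_mul, mul_one, negOnePow_sum]
    have e3 : (Finset.Iio j).erase i = Finset.univ.filter (fun r => r < j ∧ r ≠ i) := by
      ext r; simp [and_comm]
    rw [e3, Finset.prod_filter]
    conv_rhs => rw [← Equiv.prod_comp σ]
    refine Finset.prod_congr rfl fun b _ => ?_
    rw [h1']
    by_cases hb : σ b < j ∧ σ b ≠ i
    · have hb0 : b ≠ 0 := fun hh => hb.2 (by rw [hh, h0'])
      have hb1 : b ≠ 1 := fun hh => hb.1.ne (by rw [hh, h1'])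
      have hb0' : (b : ℕ) ≠ 0 := fun hh => hb0 (Fin.ext hh)
      have hb1' : (b : ℕ) ≠ 1 := fun hh => hb1 (Fin.ext hh)
      have hpos : (1 : Fin (q + 2)) < b := by
        change ((1 : Fin (q + 2)) : ℕ) < b
        simp only [Fin.val_one]
        omega
      rw [if_pos hb, if_pos ⟨hpos, hb.1⟩]
    · rw [if_neg hb, if_neg]
      rintro ⟨hh, hh2⟩
      refine hb ⟨hh2, fun hh3 => ?_⟩
      rw [← h0'] at hh3
      rw [σ.injective hh3] at hh
      exact absurd hh (Fin.not_lt_zero _)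
  rw [e0, e1, ← Int.negOnePow_add, add_assoc]

/-- The arguments `λ[v_1, v_2], v_3, …, v_p`. -/
def headTuple (lam : K) (μ : H →ₗ[K] H →ₗ[K] H) {r p : ℕ} (h : r + 1 = p) (hr : 0 < r)
    (v : Fin p → H) (t : Fin r) : H :=
  if (t : ℕ) = 0 then lam • μ (v ⟨0, by omega⟩) (v ⟨1, by omega⟩) else v ⟨t + 1, by omega⟩

/-- The degrees of the entries of `headTuple`. -/
def headDegrees {r p : ℕ} (h : r + 1 = p) (d : Fin p → ℤ) (t : Fin r) : ℤ :=
  d ⟨t + 1, by omega⟩ + if (t : ℕ) = 0 then d ⟨0, by omega⟩ + 1 else 0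

theorem headTuple_mem (lam : K) (μ : H →ₗ[K] H →ₗ[K] H)
    (hμ : ∀ {i j : ℤ} {x y : H}, x ∈ ℋ i → y ∈ ℋ j → μ x y ∈ ℋ (i + j + 1))
    {r p : ℕ} (h : r + 1 = p) (hr : 0 < r) (d : Fin p → ℤ) (v : Fin p → H)
    (hv : ∀ i, v i ∈ ℋ (d i)) (t : Fin r) :
    headTuple lam μ h hr v t ∈ ℋ (headDegrees h d t) := by
  by_cases ht : (t : ℕ) = 0
  · obtain rfl : t = ⟨0, hr⟩ := Fin.ext ht
    have := (ℋ _).smul_mem lam (hμ (hv ⟨0, by omega⟩) (hv ⟨1, by omega⟩))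
    simp only [headTuple, headDegrees, if_true]
    convert this using 2
    simp
    ring
  · simpa [headTuple, headDegrees, ht] using hv _

theorem headTuple_symm (lam : K) (μ : H →ₗ[K] H →ₗ[K] H)
    (hμ : ∀ {i j : ℤ} {x y : H}, x ∈ ℋ i → y ∈ ℋ j → μ x y ∈ ℋ (i + j + 1))
    (hμs : ∀ {i j : ℤ} {x y : H}, x ∈ ℋ i → y ∈ ℋ j → μ x y = (i * j).negOnePow • μ y x)
    {r p : ℕ} (h : r + 1 = p) (hr : 0 < r) {n : ℤ}
    {g : MultilinearMap K (fun _ : Fin r => H) G} (hg : IsGradedSymm 𝒢 ℋ n g)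
    (d : Fin p → ℤ) (v : Fin p → H) (hv : ∀ i, v i ∈ ℋ (d i)) (y : Perm (Fin p))
    (hy : blocks₂ 2 ∘ y = blocks₂ 2) :
    koszulSign y d • g (headTuple lam μ h hr (v ∘ y)) = g (headTuple lam μ h hr v) := by
  obtain ⟨s, rfl⟩ : ∃ s, r = s + 1 := ⟨r - 1, by omega⟩
  have hp : 2 + s = p := by omega
  obtain ⟨y₁, y₂, h₁, h₂, hs⟩ := exists_restrict hp y (blocks₂_comp hy)
  -- the permutation of the entries of the tuple
  have e12 : ((koszulSign y₁ fun i => d ⟨i, by omega⟩ : ℤˣ) : ℤ) •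
      μ ((v ∘ y) ⟨0, by omega⟩) ((v ∘ y) ⟨1, by omega⟩)
      = μ (v ⟨0, by omega⟩) (v ⟨1, by omega⟩) := by
    have a0 := h₁ 0
    have a1 := h₁ 1
    have hc : ∀ y₁ : Perm (Fin 2), y₁ = 1 ∨ y₁ = Equiv.swap 0 1 := by decide
    rcases hc y₁ with hc | hc
    · subst hc
      have a0' : y ⟨0, by omega⟩ = ⟨0, by omega⟩ := a0
      have a1' : y ⟨1, by omega⟩ = ⟨1, by omega⟩ := a1
      have hk : ∀ d : Fin 2 → ℤ, koszulSign 1 d = 1 := fun d => by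
        simp [koszulSign, Fin.prod_univ_two]
      rw [hk]
      simp [a0', a1']
    · subst hc
      have a0' : y ⟨0, by omega⟩ = ⟨1, by omega⟩ := a0
      have a1' : y ⟨1, by omega⟩ = ⟨0, by omega⟩ := a1
      have hk : ∀ d : Fin 2 → ℤ, koszulSign (Equiv.swap 0 1) d = (d 0 * d 1).negOnePow :=
        fun d => by simp [koszulSign, Fin.prod_univ_two, mul_comm]
      rw [hk, Function.comp_apply, Function.comp_apply, a0', a1',
        hμs (hv ⟨0, by omega⟩) (hv ⟨1, by omega⟩)]
      rfl
  have e12' : μ ((v ∘ y) ⟨0, by omega⟩) ((v ∘ y) ⟨1, by omega⟩)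
      = ((koszulSign y₁ fun i => d ⟨i, by omega⟩ : ℤˣ) : ℤ) •
        μ (v ⟨0, by omega⟩) (v ⟨1, by omega⟩) := by
    rw [← e12, smul_smul, ← Units.val_mul, koszulSign_mul_self]
    simp
  let y' : Perm (Fin (s + 1)) := Perm.decomposeFin.symm (0, y₂)
  have hy0 : y' 0 = 0 := by simp [y']
  have hys : ∀ t : Fin s, y' t.succ = (y₂ t).succ := fun t => by simp [y']
  have e : headTuple lam μ h hr (v ∘ y) = Function.update (headTuple lam μ h hr v ∘ y') 0
      (((koszulSign y₁ fun i => d ⟨i, by omega⟩ : ℤˣ) : ℤ) • headTuple lam μ h hr v 0) := by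
    funext t
    refine Fin.cases ?_ (fun t => ?_) t
    · rw [Function.update_self]
      simp only [headTuple, Fin.val_zero, if_true, e12']
      rw [smul_comm]
    · rw [Function.update_of_ne (Fin.succ_ne_zero _), Function.comp_apply, hys]
      have := h₂ t
      simp only [headTuple, Fin.val_succ, Nat.add_eq_zero_iff, one_ne_zero, and_false, if_false,
        Function.comp_apply]
      congr 1
      have h3 : (⟨(t : ℕ) + 1 + 1, by omega⟩ : Fin p) = ⟨2 + t, by omega⟩ := Fin.ext (by
        simp only; omega)
      rw [h3, this]
      apply Fin.ext
      simp only
      omega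
  have e2 : Function.update (headTuple lam μ h hr v ∘ y') 0 (headTuple lam μ h hr v 0)
      = headTuple lam μ h hr v ∘ y' := by
    rw [Function.update_eq_self_iff, Function.comp_apply, hy0]
  have e3 := hg.symm _ _ (headTuple_mem lam μ hμ h hr d v hv) y'
  have e4 : koszulSign y' (headDegrees h d) = koszulSign y₂ (fun i => d ⟨2 + i, by omega⟩) := by
    unfold koszulSign
    rw [Fin.prod_univ_succ, Finset.prod_eq_one, one_mul]
    · refine Finset.prod_congr rfl fun a _ => ?_
      rw [Fin.prod_univ_succ]
      simp only [hy0, hys, Fin.succ_lt_succ_iff, Fin.not_lt_zero, false_and, if_false, one_mul]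
      refine Finset.prod_congr rfl fun b _ => ?_
      have h3 : ∀ c : Fin s, headDegrees h d c.succ = d ⟨2 + c, by omega⟩ := by
        intro c
        simp only [headDegrees, Fin.val_succ, Nat.add_eq_zero_iff, one_ne_zero, and_false,
          if_false, add_zero]
        congr 1
        apply Fin.ext
        simp only
        omega
      simp only [h3]
    · intro b _
      rw [hy0, if_neg (fun hh => Fin.not_lt_zero _ hh.2)]
  have e5 : ∀ (z : ℤ), g (Function.update (headTuple lam μ h hr v ∘ y') 0
      (z • headTuple lam μ h hr v 0)) = z • g (headTuple lam μ h hr v ∘ y') := by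
    intro z
    rw [← Int.cast_smul_eq_zsmul K, g.map_update_smul, e2, Int.cast_smul_eq_zsmul]
  rw [e, e5, e3, e4, hs, Units.smul_def, Units.smul_def, smul_smul]
  congr 1
  rw [← Units.val_mul, mul_right_comm, koszulSign_mul_self, one_mul]

/-- The sum over `i < j` is a sum over `(2, p - 2)`-shuffles. -/
theorem sum_diffTerm (lam : K) (μ : H →ₗ[K] H →ₗ[K] H) {r p : ℕ} (h : r + 1 = p) (hr : 0 < r)
    (g : MultilinearMap K (fun _ : Fin r => H) G) (d : Fin p → ℤ) (v : Fin p → H) :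
    (∑ i : Fin p, ∑ j : Fin p, if hij : i < j then
      (d i * (∑ r ∈ Finset.Iio i, d r) + d j * (∑ r ∈ Finset.Iio j, d r) + d i * d j).negOnePow •
        diffTerm lam μ h g hij v else 0)
      = ∑ σ ∈ shuffles (blocks₂ 2), koszulSign σ d • g (headTuple lam μ h hr (v ∘ σ)) := by
  classical
  have hz : ∀ t : Fin p, (t : ℕ) = 0 → t = ⟨0, by omega⟩ := fun t ht => Fin.ext ht
  have ho : ∀ t : Fin p, (t : ℕ) = 1 → t = ⟨1, by omega⟩ := fun t ht => Fin.ext ht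
  have hlt : ∀ σ ∈ shuffles (blocks₂ (p := p) 2), σ ⟨0, by omega⟩ < σ ⟨1, by omega⟩ := by
    intro σ hσ
    exact mem_shuffles.1 hσ _ _ (by simp) (by simp [blocks₂])
  rw [← Finset.sum_product']
  symm
  refine Finset.sum_of_injOn (fun σ => (σ ⟨0, by omega⟩, σ ⟨1, by omega⟩)) ?_ (by simp) ?_ ?_
  · intro σ hσ τ hτ hh
    simp only [Prod.mk.injEq] at hh
    refine shuffle_ext hσ hτ fun t ht => ?_
    rcases (by omega : (t : ℕ) = 0 ∨ (t : ℕ) = 1) with h0 | h0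
    · rw [hz t h0, hh.1]
    · rw [ho t h0, hh.2]
  · rintro ⟨i, j⟩ _ hnot
    rw [dif_neg]
    intro hij
    obtain ⟨σ, hσ, hσt⟩ := exists_shuffle hij
    refine hnot ⟨σ, hσ, ?_⟩
    simp [Prod.ext_iff, Fin.ext_iff, hσt]
  · intro σ hσ
    have hij := hlt σ hσ
    simp only [dif_pos hij]
    rw [← koszulSign_shuffle hij hσ (fun t ht => by rw [hz t ht]) (fun t ht => by rw [ho t ht])]
    congr 1
    rw [diffTerm_apply]
    congr 1
    funext t
    unfold headTuple
    by_cases ht : (t : ℕ) = 0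
    · rw [if_pos ht, dif_pos ht]
      rfl
    · rw [if_neg ht, dif_neg ht]
      obtain ⟨τ, hτ, hτt⟩ := exists_shuffle hij
      have : σ = τ := shuffle_ext hσ hτ fun t ht => by
        rcases (by omega : (t : ℕ) = 0 ∨ (t : ℕ) = 1) with h0 | h0
        · apply Fin.ext
          rw [hτt, if_pos h0, hz t h0]
        · apply Fin.ext
          rw [hτt, if_neg (by omega), if_pos h0, ho t h0]
      rw [Function.comp_apply]
      congr 1
      apply Fin.ext
      conv_lhs => rw [this]
      rw [hτt, if_neg (by simp), if_neg (by simpa using ht)]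
      simp only
      congr 1

end Differential

section Operations

variable {K G H : Type*} [Field K] [AddCommGroup G] [Module K G] [AddCommGroup H] [Module K H]

/-- `∑_{i<j} (-1)^{s + v_i(v_1+⋯+v_{i-1}) + v_j(v_1+⋯+v_{j-1}) + v_i v_j}
g_{p-1}(λ[v_i, v_j], v_1, …, v̂_i, …, v̂_j, …, v_p)` for `v_1, …, v_p` of degrees `d`. -/
def diffSum (lam : K) (μ : H →ₗ[K] H →ₗ[K] H)
    (g : ∀ p : ℕ, MultilinearMap K (fun _ : Fin p => H) G) (s : ℤ) :
    ∀ (p : ℕ) (_ : Fin p → ℤ), MultilinearMap K (fun _ : Fin p => H) G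
  | 0, _ => 0
  | r + 1, d => ∑ i : Fin (r + 1), ∑ j : Fin (r + 1), if hij : i < j then
      (s + d i * (∑ k ∈ Finset.Iio i, d k) + d j * (∑ k ∈ Finset.Iio j, d k) + d i * d j).negOnePow •
        diffTerm lam μ rfl (g r) hij else 0

/-- `∑_{k+l=p+1} ∑_{σ ∈ S_(l,1,p-l-1)} ε(σ)
f_{k-1}(ρ(g_l(v_{σ(1)}, …, v_{σ(l)})) v_{σ(l+1)}, v_{σ(l+2)}, …, v_{σ(p)})`
for `v_1, …, v_p` of degrees `d`. -/
def rhoSum (ρ : G →ₗ[K] Module.End K H)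
    (f g : ∀ p : ℕ, MultilinearMap K (fun _ : Fin p => H) G) (p : ℕ) (d : Fin p → ℤ) :
    MultilinearMap K (fun _ : Fin p => H) G :=
  ∑ l : Fin (p + 1), ∑ σ ∈ shuffles (blocks₃ l), koszulSign σ d •
    rhoTerm ρ (q := p - l) (by omega) (f (p - l)) (g l) σ

/-- `∑_{k+l=p+1} ∑_{σ ∈ S_(k-1,l)} (-1)^{n(v_{σ(1)}+⋯+v_{σ(k-1)}) + s} ε(σ)
[f_{k-1}(v_{σ(1)}, …, v_{σ(k-1)}), g_l(v_{σ(k)}, …, v_{σ(p)})]`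
for `v_1, …, v_p` of degrees `d`; the summation index is `a = k - 1`. -/
def bracketSum (μ : G →ₗ[K] G →ₗ[K] G)
    (f g : ∀ p : ℕ, MultilinearMap K (fun _ : Fin p => H) G) (n s : ℤ) (p : ℕ) (d : Fin p → ℤ) :
    MultilinearMap K (fun _ : Fin p => H) G :=
  ∑ a : Fin (p + 1), ∑ σ ∈ shuffles (blocks₂ a),
    (n * (∑ t : Fin a, d (σ ⟨t, by omega⟩)) + s).negOnePow • koszulSign σ d •
      bracketTerm μ (b := p - a) (by omega) (f a) (g (p - a)) σ

variable {𝒢 : ℤ → Submodule K G} {ℋ : ℤ → Submodule K H}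

theorem rhoSum_mem {𝔤 : SymmGradedLie 𝒢} {𝔥 : SymmGradedLie ℋ} (ρ : SymmGradedLieAction 𝔤 𝔥)
    {m n : ℤ} {f g : ∀ p : ℕ, MultilinearMap K (fun _ : Fin p => H) G}
    (hf : f ∈ gradedHom 𝒢 ℋ m) (hg : g ∈ gradedHom 𝒢 ℋ n) (p : ℕ) :
    (∀ d v, (∀ i, v i ∈ ℋ (d i)) → rhoSum ρ.toFun f g p d v ∈ 𝒢 (∑ i, d i + (m + n + 1))) ∧
    ∀ d v, (∀ i, v i ∈ ℋ (d i)) → ∀ π : Perm (Fin p),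
      koszulSign π d • rhoSum ρ.toFun f g p (d ∘ π) (v ∘ π) = rhoSum ρ.toFun f g p d v := by
  have hρ : ∀ {i j : ℤ} {x : G} {y : H}, x ∈ 𝒢 i → y ∈ ℋ j → ρ.toFun x y ∈ ℋ (j + (i + 1)) :=
    fun hx hy => (ρ.isDerivation hx).map_mem hy
  constructor
  · intro d v hv
    simp only [rhoSum, _root_.sum_apply]
    exact Submodule.sum_mem _ fun l _ => Submodule.sum_mem _ fun σ _ =>
      units_smul_mem _ _ (rhoTerm_mem ρ.toFun hρ _ (hf _) (hg _) d v hv σ)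
  · intro d v hv π
    simp only [rhoSum, _root_.sum_apply, Finset.smul_sum (s := Finset.univ)]
    refine Finset.sum_congr rfl fun l _ => ?_
    have := sum_shuffles_symm (monotone_blocks₃ l)
      (fun _ w => rhoTerm ρ.toFun (q := p - l) (by omega) (f (p - l)) (g l) 1 w) d v
      (fun τ y hy => rhoTerm_symm ρ.toFun hρ _ (hf _) (hg _) (d ∘ τ) (v ∘ τ) (fun i => hv _) y hy) π
    simp only [← rhoTerm_eq] at this
    exact this

theorem bracketSum_mem (𝔤 : SymmGradedLie 𝒢) {m n : ℤ}
    {f g : ∀ p : ℕ, MultilinearMap K (fun _ : Fin p => H) G}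
    (hf : f ∈ gradedHom 𝒢 ℋ m) (hg : g ∈ gradedHom 𝒢 ℋ n) (s : ℤ) (p : ℕ) :
    (∀ d v, (∀ i, v i ∈ ℋ (d i)) →
      bracketSum 𝔤.bracket f g n s p d v ∈ 𝒢 (∑ i, d i + (m + n + 1))) ∧
    ∀ d v, (∀ i, v i ∈ ℋ (d i)) → ∀ π : Perm (Fin p),
      koszulSign π d • bracketSum 𝔤.bracket f g n s p (d ∘ π) (v ∘ π)
        = bracketSum 𝔤.bracket f g n s p d v := by
  constructor
  · intro d v hv
    simp only [bracketSum, _root_.sum_apply]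
    exact Submodule.sum_mem _ fun l _ => Submodule.sum_mem _ fun σ _ =>
      units_smul_mem _ _ (units_smul_mem _ _
        (bracketTerm_mem 𝔤.bracket 𝔤.bracket_mem _ (hf _) (hg _) d v hv σ))
  · intro d v hv π
    simp only [bracketSum, _root_.sum_apply, Finset.smul_sum (s := Finset.univ)]
    refine Finset.sum_congr rfl fun a _ => ?_
    have := sum_shuffles_symm (monotone_blocks₂ a)
      (fun e w => (n * (∑ t : Fin a, e ⟨t, by omega⟩) + s).negOnePow •
        bracketTerm 𝔤.bracket (b := p - a) (by omega) (f a) (g (p - a)) 1 w) d v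
      (fun τ y hy => by
        obtain ⟨y₁, y₂, h₁, -, -⟩ :=
          exists_restrict (q := p - a) (by omega) y (blocks₂_comp hy)
        have hsum : (∑ t : Fin a, ((d ∘ τ) ∘ y) ⟨t, by omega⟩)
            = ∑ t : Fin a, (d ∘ τ) ⟨t, by omega⟩ := by
          simp only [Function.comp_apply, h₁]
          exact Equiv.sum_comp y₁ (fun t : Fin a => d (τ ⟨t, by omega⟩))
        rw [hsum, smul_comm, bracketTerm_symm 𝔤.bracket _ (hf _) (hg _) (d ∘ τ) (v ∘ τ)
          (fun i => hv _) y hy]) π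
    simp only [← bracketTerm_eq] at this
    simp only [smul_comm (koszulSign _ _) (Int.negOnePow _)] at this
    exact this

variable [DirectSum.Decomposition ℋ]

theorem diffSum_mem (lam : K) (𝔥 : SymmGradedLie ℋ) {n : ℤ}
    {g : ∀ p : ℕ, MultilinearMap K (fun _ : Fin p => H) G} (hg : g ∈ gradedHom 𝒢 ℋ n)
    (s : ℤ) (p : ℕ) :
    IsGradedSymm 𝒢 ℋ (n + 1) (extend ℋ (diffSum lam 𝔥.bracket g s p)) := by
  rcases p with _ | r
  · exact isGradedSymm_extend _ (fun _ _ _ => by simp [diffSum]) (fun _ _ _ _ => by simp [diffSum])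
  rcases Nat.eq_zero_or_pos r with rfl | hr
  · have : ∀ d, diffSum lam 𝔥.bracket g s 1 d = 0 := fun d => by simp [diffSum]
    exact isGradedSymm_extend _ (fun _ _ _ => by simp [this]) (fun _ _ _ _ => by simp [this])
  have key : ∀ d v, diffSum lam 𝔥.bracket g s (r + 1) d v = s.negOnePow •
      ∑ σ ∈ shuffles (blocks₂ 2), koszulSign σ d •
        g r (headTuple lam 𝔥.bracket rfl hr (v ∘ σ)) := by
    intro d v
    rw [← sum_diffTerm]
    simp only [diffSum, _root_.sum_apply, Finset.smul_sum]
    refine Finset.sum_congr rfl fun i _ => Finset.sum_congr rfl fun j _ => ?_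
    split_ifs
    · rw [add_assoc, add_assoc, Int.negOnePow_add, ← add_assoc, mul_smul]
      rfl
    · simp
  refine isGradedSymm_extend _ (fun d v hv => ?_) (fun d v hv π => ?_)
  · rw [key]
    refine units_smul_mem _ _ (Submodule.sum_mem _ fun σ _ => units_smul_mem _ _ ?_)
    have := (hg r).map_mem _ _ (headTuple_mem lam 𝔥.bracket 𝔥.bracket_mem rfl hr (d ∘ σ) (v ∘ σ)
      (fun i => hv (σ i)))
    convert this using 2
    rw [← Equiv.sum_comp σ d, Fin.sum_univ_succ]
    unfold headDegrees
    rw [Finset.sum_add_distrib, Finset.sum_eq_single (⟨0, hr⟩ : Fin r)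
      (f := fun i : Fin r => if (i : ℕ) = 0 then _ else _)]
    · simp only [if_true, Function.comp_apply]
      have : (∑ i : Fin r, d (σ ⟨(i : ℕ) + 1, by omega⟩)) = ∑ i : Fin r, d (σ i.succ) := rfl
      rw [this]
      have h0 : (⟨0, by omega⟩ : Fin (r + 1)) = 0 := rfl
      rw [h0]
      ring
    · intro i _ hi
      rw [if_neg (fun hh => hi (Fin.ext hh))]
    · simp
  · rw [key, key, smul_comm]
    congr 1
    exact sum_shuffles_symm (monotone_blocks₂ 2)
      (fun _ w => g r (headTuple lam 𝔥.bracket rfl hr w)) d v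
      (fun τ y hy => headTuple_symm lam 𝔥.bracket 𝔥.bracket_mem 𝔥.bracket_symm rfl hr (hg r)
        (d ∘ τ) (v ∘ τ) (fun i => hv _) y hy) π

/-- The differential `d_λ : Homⁿ(S(𝔥), 𝔤) → Homⁿ⁺¹(S(𝔥), 𝔤)`. -/
noncomputable def gradedDiff (lam : K) (𝔥 : SymmGradedLie ℋ) {n : ℤ} (g : gradedHom 𝒢 ℋ n) :
    gradedHom 𝒢 ℋ (n + 1) :=
  ⟨fun p => extend ℋ (diffSum lam 𝔥.bracket g.1 (n + 1) p), diffSum_mem lam 𝔥 g.2 _⟩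

/-- The bracket `⟦·,·⟧ : Hom^m(S(𝔥), 𝔤) × Hom^n(S(𝔥), 𝔤) → Hom^{m+n+1}(S(𝔥), 𝔤)`. -/
noncomputable def gradedBracket {𝔤 : SymmGradedLie 𝒢} {𝔥 : SymmGradedLie ℋ}
    (ρ : SymmGradedLieAction 𝔤 𝔥) {m n : ℤ} (f : gradedHom 𝒢 ℋ m) (g : gradedHom 𝒢 ℋ n) :
    gradedHom 𝒢 ℋ (m + n + 1) :=
  ⟨fun p => extend ℋ fun d =>
      -rhoSum ρ.toFun f.1 g.1 p d
      + ((m + 1) * (n + 1)).negOnePow • rhoSum ρ.toFun g.1 f.1 p d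
      - bracketSum 𝔤.bracket f.1 g.1 n (m + 1) p d, fun p => by
    have h1 := rhoSum_mem ρ f.2 g.2 p
    have h2 := rhoSum_mem ρ g.2 f.2 p
    have h3 := bracketSum_mem 𝔤 f.2 g.2 (m + 1) p
    rw [add_comm n m] at h2
    refine isGradedSymm_extend _ (fun d v hv => ?_) (fun d v hv π => ?_)
    · exact (𝒢 _).sub_mem ((𝒢 _).add_mem ((𝒢 _).neg_mem (h1.1 d v hv))
        (units_smul_mem _ _ (h2.1 d v hv))) (h3.1 d v hv)
    · simp only [_root_.sub_apply, _root_.add_apply, _root_.neg_apply, _root_.smul_apply, smul_sub,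
        smul_add, smul_neg]
      rw [h1.2 d v hv, smul_comm, h2.2 d v hv, h3.2 d v hv]⟩

theorem gradedDiff_apply (lam : K) (𝔥 : SymmGradedLie ℋ) {n : ℤ} (g : gradedHom 𝒢 ℋ n)
    (p : ℕ) (d : Fin p → ℤ) (v : Fin p → H) (hv : ∀ i, v i ∈ ℋ (d i)) :
    (gradedDiff lam 𝔥 g).1 p v = diffSum lam 𝔥.bracket g.1 (n + 1) p d v :=
  extend_apply ℋ _ d v hv

theorem gradedBracket_apply {𝔤 : SymmGradedLie 𝒢} {𝔥 : SymmGradedLie ℋ}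
    (ρ : SymmGradedLieAction 𝔤 𝔥) {m n : ℤ} (f : gradedHom 𝒢 ℋ m) (g : gradedHom 𝒢 ℋ n)
    (p : ℕ) (d : Fin p → ℤ) (v : Fin p → H) (hv : ∀ i, v i ∈ ℋ (d i)) :
    (gradedBracket ρ f g).1 p v = -rhoSum ρ.toFun f.1 g.1 p d v
      + ((m + 1) * (n + 1)).negOnePow • rhoSum ρ.toFun g.1 f.1 p d v
      - bracketSum 𝔤.bracket f.1 g.1 n (m + 1) p d v :=
  extend_apply ℋ _ d v hv

end Operations

section MaurerCartan

/-- Maurer–Cartan elements of a differential graded Lie algebra `(⨁ L i, [·,·], d)`: elements `θ` of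
degree `1` such that `d θ + ½ [θ, θ] = 0`. The condition involves only the graded vector space, the
bracket (of degree `0`) and the differential (of degree `1`). -/
def IsMaurerCartan (K : Type*) [Field K] {ι : Type*} [Add ι] [One ι] {L : ι → Type*}
    [∀ i, AddCommGroup (L i)] [∀ i, Module K (L i)] (bracket : ∀ i j, L i → L j → L (i + j))
    (d : ∀ i, L i → L (i + 1)) (θ : L 1) : Prop :=
  d 1 θ + (1 / 2 : K) • bracket 1 1 θ θ = 0

variable {K G H : Type*} [Field K] [AddCommGroup G] [Module K G] [AddCommGroup H] [Module K H]

/-- `sC*(𝔥, 𝔤)`: the suspension of `C*(𝔥, 𝔤) = ⨁ Homⁿ(S(𝔥), 𝔤)`, `(sC*)ⁿ = Homⁿ⁻¹(S(𝔥), 𝔤)`. -/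
abbrev SuspHom (𝒢 : ℤ → Submodule K G) (ℋ : ℤ → Submodule K H) (n : ℤ) :=
  gradedHom 𝒢 ℋ (n - 1)

variable {𝒢 : ℤ → Submodule K G} {ℋ : ℤ → Submodule K H}

/-- An element of `C*(𝔥, 𝔤)` of degree `n` as an element of `sC*(𝔥, 𝔤)` of degree `n + 1`. -/
def susp {n a : ℤ} (h : a = n + 1) (f : gradedHom 𝒢 ℋ n) : SuspHom 𝒢 ℋ a :=
  ⟨f.1, by
    have e : a - 1 = n := by rw [h, add_sub_cancel_right]
    show f.1 ∈ gradedHom 𝒢 ℋ (a - 1)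
    rw [e]
    exact f.2⟩

/-- Homotopy `𝒪`-operators of weight `λ` with respect to the action `ρ`. In `bracketSum` with both
sign parameters equal to `0`, the only sign is the Koszul sign. -/
def IsHomotopyOOperator {𝔤 : SymmGradedLie 𝒢} {𝔥 : SymmGradedLie ℋ} (lam : K)
    (ρ : SymmGradedLieAction 𝔤 𝔥) (T : gradedHom 𝒢 ℋ 0) : Prop :=
  ∀ (p : ℕ) (d : Fin p → ℤ) (v : Fin p → H), (∀ i, v i ∈ ℋ (d i)) →
    diffSum lam 𝔥.bracket T.1 0 p d v + rhoSum ρ.toFun T.1 T.1 p d v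
      = (1 / 2 : K) • bracketSum 𝔤.bracket T.1 T.1 0 0 p d v

variable [DirectSum.Decomposition ℋ]

/-- The differential of `sC*(𝔥, 𝔤)`. -/
noncomputable def suspDiff (lam : K) (𝔥 : SymmGradedLie ℋ) (n : ℤ) (g : SuspHom 𝒢 ℋ n) :
    SuspHom 𝒢 ℋ (n + 1) :=
  susp (by ring) (gradedDiff lam 𝔥 g)

/-- The bracket of `sC*(𝔥, 𝔤)`. -/
noncomputable def suspBracket {𝔤 : SymmGradedLie 𝒢} {𝔥 : SymmGradedLie ℋ}
    (ρ : SymmGradedLieAction 𝔤 𝔥) (m n : ℤ) (f : SuspHom 𝒢 ℋ m) (g : SuspHom 𝒢 ℋ n) :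
    SuspHom 𝒢 ℋ (m + n) :=
  susp (by ring) (gradedBracket ρ f g)

end MaurerCartan

section LieAlgebra

variable {K 𝔤 𝔥 : Type*} [Field K] [LieRing 𝔤] [LieAlgebra K 𝔤] [LieRing 𝔥] [LieAlgebra K 𝔥]

/-- `𝒪`-operators of weight `λ` on a Lie algebra `𝔤` with respect to an action `ρ` on `𝔥`. -/
def IsOOperator (lam : K) (ρ : 𝔤 →ₗ⁅K⁆ LieDerivation K 𝔥 𝔥) (T : 𝔥 →ₗ[K] 𝔤) : Prop :=
  ∀ u v : 𝔥, ⁅T u, T v⁆ = T (ρ (T u) v - ρ (T v) u + lam • ⁅u, v⁆)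

/-- The Lie bracket as a bilinear map. -/
def lieBilin (K L : Type*) [Field K] [LieRing L] [LieAlgebra K L] : L →ₗ[K] L →ₗ[K] L :=
  LinearMap.mk₂ K (fun x y => ⁅x, y⁆) (fun _ _ _ => add_lie _ _ _) (fun _ _ _ => smul_lie _ _ _)
    (fun _ _ _ => lie_add _ _ _) (fun _ _ _ => lie_smul _ _ _)

/-- The action of a Lie algebra, as a linear map to the endomorphisms. -/
def lieAction (ρ : 𝔤 →ₗ⁅K⁆ LieDerivation K 𝔥 𝔥) : 𝔤 →ₗ[K] Module.End K 𝔥 :=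
  LinearMap.mk₂ K (fun x v => ρ x v) (fun _ _ _ => by simp) (fun _ _ _ => by simp)
    (fun _ _ _ => by simp) (fun _ _ _ => by simp)

/-- The grading of a vector space which is concentrated in degree `-1`. -/
def trivialGrading (K V : Type*) [Field K] [AddCommGroup V] [Module K V] (i : ℤ) : Submodule K V :=
  if i = -1 then ⊤ else ⊥

section
variable {V W : Type*} [AddCommGroup V] [Module K V] [AddCommGroup W] [Module K W]

theorem trivialGrading_cases {i : ℤ} {x : V} (h : x ∈ trivialGrading K V i) : i = -1 ∨ x = 0 := by
  unfold trivialGrading at h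
  split_ifs at h with hi
  · exact Or.inl hi
  · exact Or.inr ((Submodule.mem_bot K).1 h)

theorem mem_trivialGrading (x : V) : x ∈ trivialGrading K V (-1) := by
  simp [trivialGrading]

theorem koszulSign_neg_one {p : ℕ} (σ : Perm (Fin p)) :
    koszulSign σ (fun _ => -1) = Perm.sign σ := by
  rw [← koszulSign_one_degree]
  simp [koszulSign]

theorem isGradedSymm_of_alternating {q : ℕ} (f : V [⋀^Fin q]→ₗ[K] W) :
    IsGradedSymm (trivialGrading K W) (trivialGrading K V) ((q : ℤ) - 1) f.toMultilinearMap := by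
  have hd : ∀ (d : Fin q → ℤ) (v : Fin q → V), (∀ i, v i ∈ trivialGrading K V (d i)) →
      d = (fun _ => -1) ∨ ∃ i, v i = 0 := by
    intro d v h
    by_cases h0 : ∃ i, v i = 0
    · exact Or.inr h0
    · refine Or.inl (funext fun i => ?_)
      exact (trivialGrading_cases (h i)).resolve_right fun hh => h0 ⟨i, hh⟩
  constructor
  · intro d v h
    rcases hd d v h with rfl | ⟨i, hi⟩
    · have : (∑ _i : Fin q, (-1 : ℤ)) + ((q : ℤ) - 1) = -1 := by simp; ring
      rw [this]
      exact mem_trivialGrading _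
    · have : f.toMultilinearMap v = 0 := f.toMultilinearMap.map_coord_zero i hi
      rw [this]
      exact Submodule.zero_mem _
  · intro d v h σ
    rcases hd d v h with rfl | ⟨i, hi⟩
    · rw [koszulSign_neg_one]
      have : f.toMultilinearMap (v ∘ σ) = Perm.sign σ • f.toMultilinearMap v := f.map_perm v σ
      rw [this, smul_smul, Int.units_mul_self, one_smul]
    · rw [f.toMultilinearMap.map_coord_zero i hi,
        f.toMultilinearMap.map_coord_zero (σ.symm i) (by simpa using hi), smul_zero]

/-- The alternating map with underlying multilinear map `F`, for `F` antisymmetric. -/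
def mkAlternating [CharZero K] {p : ℕ} (F : MultilinearMap K (fun _ : Fin p => V) W)
    (hF : ∀ v, ∀ π : Perm (Fin p), Perm.sign π • F (v ∘ π) = F v) : V [⋀^Fin p]→ₗ[K] W where
  toMultilinearMap := F
  map_eq_zero_of_eq' v i j hv hij := by
    change F v = 0
    have h := hF v (Equiv.swap i j)
    have hs : v ∘ Equiv.swap i j = v := by
      funext k
      rw [Function.comp_apply, Equiv.swap_apply_def]
      split_ifs with h1 h2
      · rw [h1, hv]
      · rw [h2, hv]
      · rfl
    rw [Perm.sign_swap hij, hs, Units.neg_smul, one_smul] at h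
    have h2 : (2 : K) • F v = 0 := by rw [two_smul]; nth_rw 1 [← h]; simp
    exact (smul_eq_zero.1 h2).resolve_left two_ne_zero

end

theorem lieBilin_mem (L : Type*) [LieRing L] [LieAlgebra K L] {i j : ℤ} {x y : L}
    (hx : x ∈ trivialGrading K L i) (hy : y ∈ trivialGrading K L j) :
    lieBilin K L x y ∈ trivialGrading K L (i + j + 1) := by
  rcases trivialGrading_cases hx with rfl | rfl
  · rcases trivialGrading_cases hy with rfl | rfl
    · exact mem_trivialGrading _
    · simp
  · simp

theorem lieBilin_symm (L : Type*) [LieRing L] [LieAlgebra K L] {i j : ℤ} {x y : L}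
    (hx : x ∈ trivialGrading K L i) (hy : y ∈ trivialGrading K L j) :
    lieBilin K L x y = (i * j).negOnePow • lieBilin K L y x := by
  rcases trivialGrading_cases hx with rfl | rfl
  · rcases trivialGrading_cases hy with rfl | rfl
    · simp [lieBilin]
    · simp
  · simp

theorem lieAction_mem (ρ : 𝔤 →ₗ⁅K⁆ LieDerivation K 𝔥 𝔥) {i j : ℤ} {x : 𝔤} {y : 𝔥}
    (hx : x ∈ trivialGrading K 𝔤 i) (hy : y ∈ trivialGrading K 𝔥 j) :
    lieAction ρ x y ∈ trivialGrading K 𝔥 (j + (i + 1)) := by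
  rcases trivialGrading_cases hx with rfl | rfl
  · simpa using (by
      rcases trivialGrading_cases hy with rfl | rfl
      · exact mem_trivialGrading _
      · simp : lieAction ρ x y ∈ trivialGrading K 𝔥 j)
  · simp

variable [CharZero K]

/-- The differential `(d_λ g)(v_1, …, v_{n+1}) = ∑_{i<j} (-1)^{n+i+j-1}
g(λ[v_i, v_j], v_1, …, v̂_i, …, v̂_j, …, v_{n+1})` from `Hom(⋀ⁿ 𝔥, 𝔤)` to `Hom(⋀ⁿ⁺¹ 𝔥, 𝔤)`.
In the code `i` and `j` are counted from `0`. -/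
def lieDiff (lam : K) (n : ℕ) (g : 𝔥 [⋀^Fin n]→ₗ[K] 𝔤) : 𝔥 [⋀^Fin (n + 1)]→ₗ[K] 𝔤 :=
  mkAlternating (∑ i : Fin (n + 1), ∑ j : Fin (n + 1), if hij : i < j then
      ((-1 : ℤˣ) ^ (n + (i + 1) + (j + 1) - 1 : ℕ)) •
        diffTerm lam (lieBilin K 𝔥) rfl g.toMultilinearMap hij else 0) <| by
  rcases Nat.eq_zero_or_pos n with rfl | hr
  · intro v π
    simp
  have key : ∀ v : Fin (n + 1) → 𝔥, (∑ i : Fin (n + 1), ∑ j : Fin (n + 1), if hij : i < j then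
      ((-1 : ℤˣ) ^ (n + (i + 1) + (j + 1) - 1 : ℕ)) •
        diffTerm lam (lieBilin K 𝔥) rfl g.toMultilinearMap hij else 0) v
      = (-1 : ℤˣ) ^ n • ∑ σ ∈ shuffles (blocks₂ 2), koszulSign σ (fun _ => -1) •
        g.toMultilinearMap (headTuple lam (lieBilin K 𝔥) rfl hr (v ∘ σ)) := by
    intro v
    rw [← sum_diffTerm]
    simp only [_root_.sum_apply, Finset.smul_sum]
    refine Finset.sum_congr rfl fun i _ => Finset.sum_congr rfl fun j _ => ?_
    split_ifs
    · have e : (-1 : ℤ) * (∑ _k ∈ Finset.Iio i, (-1 : ℤ)) + -1 * (∑ _k ∈ Finset.Iio j, (-1 : ℤ))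
          + -1 * -1 = ((i + j + 1 : ℕ) : ℤ) := by simp
      rw [e, smul_smul, _root_.smul_apply, Int.negOnePow_def, zpow_natCast, ← pow_add]
      congr 2
      omega
    · simp
  intro v π
  have hv : ∀ w : Fin (n + 1) → 𝔥, ∀ i, w i ∈ trivialGrading K 𝔥 ((fun _ => -1 : Fin (n + 1) → ℤ) i) :=
    fun w i => mem_trivialGrading _
  have h1 := sum_shuffles_symm (monotone_blocks₂ 2)
    (fun _ w => g.toMultilinearMap (headTuple lam (lieBilin K 𝔥) rfl hr w))
    (fun _ => -1) v (fun τ y hy => headTuple_symm lam (lieBilin K 𝔥) (lieBilin_mem 𝔥)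
      (lieBilin_symm 𝔥) rfl hr (isGradedSymm_of_alternating g) _ (v ∘ τ) (hv _) y hy) π
  have hc : ((fun _ => -1 : Fin (n + 1) → ℤ) ∘ π) = fun _ => -1 := rfl
  rw [hc, koszulSign_neg_one] at h1
  rw [key, key, smul_comm]
  exact congrArg _ h1

theorem lieDiff_apply (lam : K) (n : ℕ) (g : 𝔥 [⋀^Fin n]→ₗ[K] 𝔤) (v : Fin (n + 1) → 𝔥) :
    lieDiff lam n g v = ∑ i : Fin (n + 1), ∑ j : Fin (n + 1), if hij : i < j then
      ((-1 : ℤˣ) ^ (n + (i + 1) + (j + 1) - 1 : ℕ)) •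
        diffTerm lam (lieBilin K 𝔥) rfl g.toMultilinearMap hij v else 0 := by
  have : lieDiff lam n g v = (lieDiff lam n g).toMultilinearMap v := rfl
  rw [this]
  simp only [lieDiff, mkAlternating, _root_.sum_apply]
  refine Finset.sum_congr rfl fun i _ => Finset.sum_congr rfl fun j _ => ?_
  split_ifs <;> rfl

/-- The bracket `Hom(⋀ⁿ 𝔥, 𝔤) × Hom(⋀ᵐ 𝔥, 𝔤) → Hom(⋀ⁿ⁺ᵐ 𝔥, 𝔤)`,
`⟦g₁, g₂⟧ = - ∑_{σ ∈ S_(m,1,n-1)} (-1)^σ g₁(ρ(g₂(v_{σ(1)}, …)) v_{σ(m+1)}, …)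
+ (-1)^{mn} ∑_{σ ∈ S_(n,1,m-1)} (-1)^σ g₂(ρ(g₁(v_{σ(1)}, …)) v_{σ(n+1)}, …)
- (-1)^{mn} ∑_{σ ∈ S_(n,m)} (-1)^σ [g₁(v_{σ(1)}, …, v_{σ(n)}), g₂(v_{σ(n+1)}, …, v_{σ(n+m)})]`. -/
def lieBracket (ρ : 𝔤 →ₗ⁅K⁆ LieDerivation K 𝔥 𝔥) (n m : ℕ)
    (g₁ : 𝔥 [⋀^Fin n]→ₗ[K] 𝔤) (g₂ : 𝔥 [⋀^Fin m]→ₗ[K] 𝔤) : 𝔥 [⋀^Fin (n + m)]→ₗ[K] 𝔤 :=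
  mkAlternating (
    -(∑ σ ∈ shuffles (blocks₃ m), Perm.sign σ •
      rhoTerm (lieAction ρ) (add_comm m n) g₁.toMultilinearMap g₂.toMultilinearMap σ)
    + ((-1 : ℤˣ) ^ (m * n)) • (∑ σ ∈ shuffles (blocks₃ n), Perm.sign σ •
      rhoTerm (lieAction ρ) rfl g₂.toMultilinearMap g₁.toMultilinearMap σ)
    - ((-1 : ℤˣ) ^ (m * n)) • (∑ σ ∈ shuffles (blocks₂ n), Perm.sign σ •
      bracketTerm (lieBilin K 𝔤) rfl g₁.toMultilinearMap g₂.toMultilinearMap σ)) <| by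
  intro v π
  have hv : ∀ w : Fin (n + m) → 𝔥, ∀ i, w i ∈ trivialGrading K 𝔥 ((fun _ => -1 : Fin (n + m) → ℤ) i) :=
    fun w i => mem_trivialGrading _
  have h1 := sum_shuffles_symm (monotone_blocks₃ m)
    (fun _ w => rhoTerm (lieAction ρ) (add_comm m n) g₁.toMultilinearMap g₂.toMultilinearMap 1 w)
    (fun _ => -1) v (fun τ y hy => rhoTerm_symm (lieAction ρ) (lieAction_mem ρ) _
      (isGradedSymm_of_alternating g₁) (isGradedSymm_of_alternating g₂) _ (v ∘ τ) (hv _) y hy) π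
  have h2 := sum_shuffles_symm (monotone_blocks₃ n)
    (fun _ w => rhoTerm (lieAction ρ) rfl g₂.toMultilinearMap g₁.toMultilinearMap 1 w)
    (fun _ => -1) v (fun τ y hy => rhoTerm_symm (lieAction ρ) (lieAction_mem ρ) _
      (isGradedSymm_of_alternating g₂) (isGradedSymm_of_alternating g₁) _ (v ∘ τ) (hv _) y hy) π
  have h3 := sum_shuffles_symm (monotone_blocks₂ n)
    (fun _ w => bracketTerm (lieBilin K 𝔤) rfl g₁.toMultilinearMap g₂.toMultilinearMap 1 w)
    (fun _ => -1) v (fun τ y hy => bracketTerm_symm (lieBilin K 𝔤) _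
      (isGradedSymm_of_alternating g₁) (isGradedSymm_of_alternating g₂) _ (v ∘ τ) (hv _) y hy) π
  have hc : ((fun _ => -1 : Fin (n + m) → ℤ) ∘ π) = fun _ => -1 := rfl
  simp only [hc, koszulSign_neg_one, ← rhoTerm_eq, ← bracketTerm_eq] at h1 h2 h3
  simp only [_root_.sub_apply, _root_.add_apply, _root_.neg_apply, _root_.smul_apply,
    _root_.sum_apply, smul_sub, smul_add, smul_neg] at h1 h2 h3 ⊢
  rw [h1, smul_comm, h2, smul_comm, h3]

theorem lieBracket_apply (ρ : 𝔤 →ₗ⁅K⁆ LieDerivation K 𝔥 𝔥) (n m : ℕ)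
    (g₁ : 𝔥 [⋀^Fin n]→ₗ[K] 𝔤) (g₂ : 𝔥 [⋀^Fin m]→ₗ[K] 𝔤) (v : Fin (n + m) → 𝔥) :
    lieBracket ρ n m g₁ g₂ v =
      -(∑ σ ∈ shuffles (blocks₃ m), Perm.sign σ •
        rhoTerm (lieAction ρ) (add_comm m n) g₁.toMultilinearMap g₂.toMultilinearMap σ v)
      + ((-1 : ℤˣ) ^ (m * n)) • (∑ σ ∈ shuffles (blocks₃ n), Perm.sign σ •
        rhoTerm (lieAction ρ) rfl g₂.toMultilinearMap g₁.toMultilinearMap σ v)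
      - ((-1 : ℤˣ) ^ (m * n)) • (∑ σ ∈ shuffles (blocks₂ n), Perm.sign σ •
        bracketTerm (lieBilin K 𝔤) rfl g₁.toMultilinearMap g₂.toMultilinearMap σ v) := by
  have : lieBracket ρ n m g₁ g₂ v = (lieBracket ρ n m g₁ g₂).toMultilinearMap v := rfl
  rw [this]
  simp only [lieBracket, mkAlternating, _root_.sub_apply, _root_.add_apply, _root_.neg_apply,
    _root_.smul_apply, _root_.sum_apply]

end LieAlgebra

end HomotopyO

namespace HomotopyO

open Equiv

section Graded

variable {K G H : Type*} [Field K] [AddCommGroup G] [Module K G] [AddCommGroup H] [Module K H]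
variable {𝒢 : ℤ → Submodule K G} {ℋ : ℤ → Submodule K H}

/-- A multilinear map on a graded vector space vanishes if it vanishes on homogeneous elements. -/
theorem multilinearMap_eq_zero_of_homogeneous [DirectSum.Decomposition ℋ] {p : ℕ}
    (f : MultilinearMap K (fun _ : Fin p => H) G)
    (h : ∀ (d : Fin p → ℤ) (v : Fin p → H), (∀ i, v i ∈ ℋ (d i)) → f v = 0) : f = 0 := by
  classical
  ext v
  have hv : v = fun i => ∑ j ∈ (DirectSum.decompose ℋ (v i)).support,
      (DirectSum.decompose ℋ (v i) j : H) :=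
    funext fun i => (DirectSum.sum_support_decompose ℋ (v i)).symm
  rw [hv, MultilinearMap.map_sum_finset]
  exact Finset.sum_eq_zero fun d _ => h d _ fun i => SetLike.coe_mem _

theorem diffSum_one (lam : K) (μ : H →ₗ[K] H →ₗ[K] H)
    (g : ∀ p : ℕ, MultilinearMap K (fun _ : Fin p => H) G) (p : ℕ) (d : Fin p → ℤ) :
    diffSum lam μ g 1 p d = -diffSum lam μ g 0 p d := by
  rcases p with _ | r
  · simp [diffSum]
  · simp only [diffSum, ← Finset.sum_neg_distrib]
    refine Finset.sum_congr rfl fun i _ => Finset.sum_congr rfl fun j _ => ?_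
    split_ifs
    · simp only [add_assoc, Int.negOnePow_add, Int.negOnePow_one, Int.negOnePow_zero, one_mul,
        neg_one_mul, Units.neg_smul]
    · simp

theorem bracketSum_zero_one (μ : G →ₗ[K] G →ₗ[K] G)
    (f g : ∀ p : ℕ, MultilinearMap K (fun _ : Fin p => H) G) (p : ℕ) (d : Fin p → ℤ) :
    bracketSum μ f g 0 1 p d = -bracketSum μ f g 0 0 p d := by
  simp [bracketSum, Units.neg_smul]

variable [DirectSum.Decomposition ℋ]

/-- The Maurer–Cartan expression of a map of degree `0` on homogeneous elements. -/
theorem maurerCartan_apply [CharZero K] {𝔤 : SymmGradedLie 𝒢} {𝔥 : SymmGradedLie ℋ} (lam : K)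
    (ρ : SymmGradedLieAction 𝔤 𝔥) (T : SuspHom 𝒢 ℋ 1) (p : ℕ) (d : Fin p → ℤ) (v : Fin p → H)
    (hv : ∀ i, v i ∈ ℋ (d i)) :
    (suspDiff lam 𝔥 1 T + (1 / 2 : K) • suspBracket ρ 1 1 T T).1 p v
      = (1 / 2 : K) • bracketSum 𝔤.bracket T.1 T.1 0 0 p d v
        - (diffSum lam 𝔥.bracket T.1 0 p d v + rhoSum ρ.toFun T.1 T.1 p d v) := by
  have h1 : (suspDiff lam 𝔥 1 T).1 p v = -diffSum lam 𝔥.bracket T.1 0 p d v :=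
    (gradedDiff_apply lam 𝔥 T p d v hv).trans
      (congrArg (fun F : MultilinearMap K (fun _ : Fin p => H) G => F v)
        (diffSum_one lam 𝔥.bracket T.1 p d))
  have h2 : (suspBracket ρ 1 1 T T).1 p v
      = bracketSum 𝔤.bracket T.1 T.1 0 0 p d v - (2 : K) • rhoSum ρ.toFun T.1 T.1 p d v := by
    refine (gradedBracket_apply ρ T T p d v hv).trans ?_
    have e : ((1 - 1 : ℤ) + 1) = 1 := by norm_num
    have e' : bracketSum 𝔤.bracket T.1 T.1 (1 - 1) 1 p d = -bracketSum 𝔤.bracket T.1 T.1 0 0 p d :=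
      bracketSum_zero_one 𝔤.bracket T.1 T.1 p d
    rw [e, e', mul_one, Int.negOnePow_one, Units.neg_smul, one_smul, two_smul,
      _root_.neg_apply]
    abel
  have h3 : (suspDiff lam 𝔥 1 T + (1 / 2 : K) • suspBracket ρ 1 1 T T).1 p v
      = (suspDiff lam 𝔥 1 T).1 p v + (1 / 2 : K) • (suspBracket ρ 1 1 T T).1 p v := rfl
  rw [h3, h1, h2, smul_sub, smul_smul, one_div, inv_mul_cancel₀ (two_ne_zero' K), one_smul]
  abel

theorem isHomotopyOOperator_iff_isMaurerCartan [CharZero K] {𝔤 : SymmGradedLie 𝒢}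
    {𝔥 : SymmGradedLie ℋ} (lam : K) (ρ : SymmGradedLieAction 𝔤 𝔥) (T : gradedHom 𝒢 ℋ 0) :
    IsHomotopyOOperator lam ρ T ↔
      IsMaurerCartan K (L := fun n : ℤ => SuspHom 𝒢 ℋ n) (suspBracket ρ) (suspDiff lam 𝔥)
        (susp (zero_add 1).symm T) := by
  constructor
  · intro h
    refine Subtype.ext (funext fun p => multilinearMap_eq_zero_of_homogeneous (ℋ := ℋ) _
      fun d v hv => (maurerCartan_apply lam ρ (susp (zero_add 1).symm T) p d v hv).trans ?_)
    exact sub_eq_zero.2 (h p d v hv).symm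
  · intro h p d v hv
    have h1 := maurerCartan_apply lam ρ (susp (zero_add 1).symm T) p d v hv
    have h2 : (suspDiff lam 𝔥 1 (susp (zero_add 1).symm T) + (1 / 2 : K) •
        suspBracket ρ 1 1 (susp (zero_add 1).symm T) (susp (zero_add 1).symm T)).1 p v = 0 :=
      congrArg (fun f : SuspHom 𝒢 ℋ (1 + 1) => f.1 p v) h
    exact (sub_eq_zero.1 (h1.symm.trans h2)).symm

end Graded

section LieAlgebra

variable {K 𝔤 𝔥 : Type*} [Field K] [CharZero K] [LieRing 𝔤] [LieAlgebra K 𝔤] [LieRing 𝔥]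
  [LieAlgebra K 𝔥]

theorem lieDiff_one_apply (lam : K) (T : 𝔥 →ₗ[K] 𝔤) (v : Fin 2 → 𝔥) :
    lieDiff lam 1 (AlternatingMap.ofSubsingleton K 𝔥 𝔤 (0 : Fin 1) T) v
      = -T (lam • ⁅v 0, v 1⁆) := by
  rw [lieDiff_apply]
  simp [Fin.sum_univ_two, diffTerm_apply, lieBilin, AlternatingMap.ofSubsingleton,
    Units.neg_smul, pow_succ]

theorem sum_shuffles_two {M : Type*} [AddCommMonoid M] {c : Fin 2 → ℕ} (hc : c 0 ≠ c 1)
    (F : Perm (Fin 2) → M) : ∑ σ ∈ shuffles c, F σ = F 1 + F (Equiv.swap 0 1) := by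
  have e : shuffles c = {1, Equiv.swap 0 1} := by
    ext σ
    have hσ : σ = 1 ∨ σ = Equiv.swap 0 1 := by revert σ; decide
    simp only [mem_shuffles, Finset.mem_insert, Finset.mem_singleton, hσ, iff_true]
    intro i j hij h
    fin_cases i <;> fin_cases j <;> simp_all
  rw [e, Finset.sum_pair (by decide)]

theorem lieBracket_one_apply (ρ : 𝔤 →ₗ⁅K⁆ LieDerivation K 𝔥 𝔥) (T : 𝔥 →ₗ[K] 𝔤)
    (v : Fin 2 → 𝔥) :
    lieBracket ρ 1 1 (AlternatingMap.ofSubsingleton K 𝔥 𝔤 (0 : Fin 1) T)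
        (AlternatingMap.ofSubsingleton K 𝔥 𝔤 (0 : Fin 1) T) v
      = (2 : K) • (⁅T (v 0), T (v 1)⁆ - T (ρ (T (v 0)) (v 1) - ρ (T (v 1)) (v 0))) := by
  have h3 : blocks₃ 1 (0 : Fin 2) ≠ blocks₃ 1 (1 : Fin 2) := by decide
  have h2 : blocks₂ 1 (0 : Fin 2) ≠ blocks₂ 1 (1 : Fin 2) := by decide
  rw [lieBracket_apply]
  erw [sum_shuffles_two h3, sum_shuffles_two h2]
  simp [rhoTerm_apply, rhoTuple, bracketTerm_apply, lieBilin, lieAction,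
    AlternatingMap.ofSubsingleton, Units.neg_smul, two_smul]
  rw [← lie_skew (T (v 0)) (T (v 1))]
  abel

theorem isOOperator_iff_isMaurerCartan (lam : K) (ρ : 𝔤 →ₗ⁅K⁆ LieDerivation K 𝔥 𝔥)
    (T : 𝔥 →ₗ[K] 𝔤) :
    IsOOperator lam ρ T ↔
      IsMaurerCartan K (L := fun n : ℕ => 𝔥 [⋀^Fin n]→ₗ[K] 𝔤) (lieBracket ρ) (lieDiff lam)
        (AlternatingMap.ofSubsingleton K 𝔥 𝔤 (0 : Fin 1) T) := by
  set θ := AlternatingMap.ofSubsingleton K 𝔥 𝔤 (0 : Fin 1) T with hθ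
  have key : ∀ v : Fin 2 → 𝔥, (lieDiff lam 1 θ + (1 / 2 : K) • lieBracket ρ 1 1 θ θ) v
      = ⁅T (v 0), T (v 1)⁆ - T (ρ (T (v 0)) (v 1) - ρ (T (v 1)) (v 0) + lam • ⁅v 0, v 1⁆) := by
    intro v
    have h : (lieDiff lam 1 θ + (1 / 2 : K) • lieBracket ρ 1 1 θ θ) v
      = lieDiff lam 1 θ v + (1 / 2 : K) • lieBracket ρ 1 1 θ θ v := rfl
    rw [h, hθ, lieDiff_one_apply, lieBracket_one_apply, smul_smul, one_div,
      inv_mul_cancel₀ (two_ne_zero' K), one_smul, map_add]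
    abel
  constructor
  · intro h
    exact AlternatingMap.ext fun v => (key v).trans (sub_eq_zero.2 (h (v 0) (v 1)))
  · intro h u w
    have h1 : (lieDiff lam 1 θ + (1 / 2 : K) • lieBracket ρ 1 1 θ θ) ![u, w] = 0 :=
      congrArg (fun f : 𝔥 [⋀^Fin 2]→ₗ[K] 𝔤 => f ![u, w]) h
    exact sub_eq_zero.1 ((key ![u, w]).symm.trans h1)

end LieAlgebra

end HomotopyO

theorem mainTheorem2 {K : Type*} [Field K] [CharZero K] (lam : K) :
    (∀ {G H : Type*} [AddCommGroup G] [Module K G] [AddCommGroup H] [Module K H]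
        (𝒢 : ℤ → Submodule K G) [DirectSum.Decomposition 𝒢]
        (ℋ : ℤ → Submodule K H) [DirectSum.Decomposition ℋ]
        (𝔤 : HomotopyO.SymmGradedLie 𝒢) (𝔥 : HomotopyO.SymmGradedLie ℋ)
        (ρ : HomotopyO.SymmGradedLieAction 𝔤 𝔥) (T : HomotopyO.gradedHom 𝒢 ℋ 0),
        HomotopyO.IsHomotopyOOperator lam ρ T ↔
          HomotopyO.IsMaurerCartan K (L := fun n : ℤ => HomotopyO.SuspHom 𝒢 ℋ n)
            (HomotopyO.suspBracket ρ) (HomotopyO.suspDiff lam 𝔥)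
            (HomotopyO.susp (zero_add 1).symm T)) ∧
    (∀ {𝔤 𝔥 : Type*} [LieRing 𝔤] [LieAlgebra K 𝔤] [LieRing 𝔥] [LieAlgebra K 𝔥]
        (ρ : 𝔤 →ₗ⁅K⁆ LieDerivation K 𝔥 𝔥) (T : 𝔥 →ₗ[K] 𝔤),
        HomotopyO.IsOOperator lam ρ T ↔
          HomotopyO.IsMaurerCartan K (L := fun n : ℕ => 𝔥 [⋀^Fin n]→ₗ[K] 𝔤)
            (HomotopyO.lieBracket ρ) (HomotopyO.lieDiff lam)
            (AlternatingMap.ofSubsingleton K 𝔥 𝔤 (0 : Fin 1) T)) := by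
  refine ⟨?_, ?_⟩
  · intro G H _ _ _ _ 𝒢 _ ℋ _ 𝔤 𝔥 ρ T
    exact HomotopyO.isHomotopyOOperator_iff_isMaurerCartan lam ρ T
  · intro 𝔤 𝔥 _ _ _ _ ρ T
    exact HomotopyO.isOOperator_iff_isMaurerCartan lam ρ T
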